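/- Let $A$ be a unital C*-algebra, let $A=\mathcal R_0\supseteq\mathcal R_1\supseteq\cdots$ be closed unital *-subalgebras, and let $E_n\colon A\to\mathcal R_n$ $(n\ge 0)$ be faithful conditional expectations onto $\mathcal R_n$ with $E_{n+1}\circ E_n=E_{n+1}$. Let $\mathcal T$ be the universal unital C*-algebra generated by (a unital copy of) $A$ and projections $\hat e_n$ $(n\ge0)$ subject to $\hat e_0=1$, $\hat e_{n+1}\hat e_n=\hat e_{n+1}$ and $\hat e_n a\hat e_n=E_n(a)\hat e_n$ for $a\in A$. Let $\hat{\mathcal K}_n$ be the closed linear span of $\{a\hat e_n b: a,b\in A\}$ in $\mathcal T$, and let $C^*(\mathcal R,\mathcal E)$ be the quotient of $\mathcal T$ by the closed two-sided ideal generated by all sums $k_0+\cdots+k_n$, where $n\ge 0$, $k_i\in\hat{\mathcal K}_i$, and $\sum_{i=0}^n k_ix=0$ for every $x\in\hat{\mathcal K}_n$. Let $e_n$ be the image of $\hat e_n$ in $C^*(\mathcal R,\mathcal E)$, and regard $A$ as a subalgebra of $C^*(\mathcal R,\mathcal E)$ through the canonical map. A conditional expectation $E\colon B\to C\subseteq B$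 is of index-finite type (in the sense of Watatani) if it has a quasi-basis, i.e. finitely many pairs $(u_i,v_i)\in B\times B$ with $\sum_i u_iE(v_ix)=x=\sum_iE(xu_i)v_i$ for all $x\in B$; then $\operatorname{ind}(E)=\sum_iu_iv_i$, which does not depend on the quasi-basis. Proposition 6.5. Suppose that every $E_n$ is of index-finite type. Then, for every $n\ge0$, the restriction $E_{n+1}|_{\mathcal R_n}\colon\mathcal R_n\to\mathcal R_{n+1}$ is of index-finite type and $\lambda_n=\operatorname{ind}(E_{n+1}|_{\mathcal R_n})$ is invertible, and there exists a conditional expectation $G\colon C^*(\mathcal R,\mathcal E)\to A$ such that $$G(e_n)=\lambda_0^{-1}\lambda_1^{-1}\cdots\lambda_{n-1}^{-1}\qquad\text{for every } n\ge0$$ (so that $G(e_0)=1$). If $A$ is commutative, then $G$ is the unique conditional expectation from $C^*(\mathcal R,\mathcal E)$ to $A$. -/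

import Mathlib

open scoped ENNReal

universe u

namespace ApproxProper

/-! ### Conditional expectations and their index -/

section CondExp

variable {B C : Type*} [Ring B] [StarRing B] [Algebra ℂ B] [Ring C] [StarRing C] [Algebra ℂ C]

/-- `E` is a conditional expectation of `B` onto `C`, where `C` is regarded as a unital
*-subalgebra of `B` by means of `ι`: a linear retraction of `ι` which is a `C`-bimodule map and
is positive.  (In a C*-algebra the positive elements are exactly those of the form `y* y`.) -/
structure IsConditionalExpectation (ι : C →⋆ₐ[ℂ] B) (E : B →ₗ[ℂ] C) : Prop where
  apply_incl : ∀ c : C, E (ι c) = c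
  map_incl_mul : ∀ (c : C) (x : B), E (ι c * x) = c * E x
  map_mul_incl : ∀ (x : B) (c : C), E (x * ι c) = E x * c
  positive : ∀ x : B, ∃ y : C, E (star x * x) = star y * y

/-- A quasi-basis, in the sense of Watatani, of a map `E : B → C ⊆ B`: a finite family of pairs
`(u i, v i)` in `B` with `∑ u i E(v i x) = x = ∑ E(x u i) v i` for all `x` in `B`. -/
structure IsQuasiBasis (ι : C →⋆ₐ[ℂ] B) (E : B →ₗ[ℂ] C) {k : ℕ} (u v : Fin k → B) : Prop where
  sum_left : ∀ x : B, ∑ i, u i * ι (E (v i * x)) = x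
  sum_right : ∀ x : B, ∑ i, ι (E (x * u i)) * v i = x

/-- `E` is of index-finite type: it has a quasi-basis. -/
def IsIndexFinite (ι : C →⋆ₐ[ℂ] B) (E : B →ₗ[ℂ] C) : Prop :=
  ∃ (k : ℕ) (u v : Fin k → B), IsQuasiBasis ι E u v

open Classical in
/-- The index `∑ u i v i` of `E`, for any quasi-basis `(u i, v i)` (it does not depend on the
choice, see `IsQuasiBasis.index_eq`); the value is `0` if there is no quasi-basis. -/
noncomputable def index (ι : C →⋆ₐ[ℂ] B) (E : B →ₗ[ℂ] C) : B :=
  if h : IsIndexFinite ι E then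
    ∑ i, h.choose_spec.choose i * h.choose_spec.choose_spec.choose i
  else 0

theorem IsQuasiBasis.sum_mul_eq {ι : C →⋆ₐ[ℂ] B} {E : B →ₗ[ℂ] C} {k l : ℕ}
    {u v : Fin k → B} {u' v' : Fin l → B} (h : IsQuasiBasis ι E u v)
    (h' : IsQuasiBasis ι E u' v') : ∑ i, u i * v i = ∑ j, u' j * v' j := by
  calc ∑ i, u i * v i = ∑ i, u i * ∑ j, ι (E (v i * u' j)) * v' j := by
        simp_rw [h'.sum_right]
    _ = ∑ j, (∑ i, u i * ι (E (v i * u' j))) * v' j := by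
        simp_rw [Finset.mul_sum, Finset.sum_mul, mul_assoc]
        exact Finset.sum_comm
    _ = ∑ j, u' j * v' j := by simp_rw [h.sum_left]

theorem IsQuasiBasis.index_eq {ι : C →⋆ₐ[ℂ] B} {E : B →ₗ[ℂ] C} {k : ℕ} {u v : Fin k → B}
    (h : IsQuasiBasis ι E u v) : index ι E = ∑ i, u i * v i := by
  have hf : IsIndexFinite ι E := ⟨k, u, v, h⟩
  rw [index, dif_pos hf]
  exact IsQuasiBasis.sum_mul_eq hf.choose_spec.choose_spec.choose_spec h

end CondExp

/-! ### Quotients of C*-algebras by closed two-sided ideals -/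

section CStarQuotient
variable {T : Type*} [CStarAlgebra T]

/-- An element `j` of a two-sided ideal has an approximate right unit inside the ideal. -/
theorem exists_approx_unit (J : Ideal T) [J.IsTwoSided] {j : T} (hj : j ∈ J) {ε : ℝ} (hε : 0 < ε) :
    ∃ e ∈ J, star e = e ∧ ‖1 - e‖ ≤ 1 ∧ ‖j * (1 - e)‖ ≤ ε := by
  let _ : PartialOrder T := CStarAlgebra.spectralOrder T
  let _ : StarOrderedRing T := CStarAlgebra.spectralOrderedRing T
  have hδ : 0 < ε ^ 2 := by positivity
  set δ := ε ^ 2 with hδdef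
  set h : T := star j * j with hh
  have hsa : IsSelfAdjoint h := IsSelfAdjoint.star_mul_self j
  have hnn : 0 ≤ h := star_mul_self_nonneg j
  have hspec : ∀ x ∈ spectrum ℝ h, 0 ≤ x := fun x hx => spectrum_nonneg_of_nonneg hnn hx
  have hc : ContinuousOn (fun t : ℝ => (t + δ)⁻¹) (spectrum ℝ h) :=
    ContinuousOn.inv₀ (by fun_prop) fun x hx => by have := hspec x hx; positivity
  set g : T := cfc (fun t : ℝ => (t + δ)⁻¹) h with hg
  have hgsa : IsSelfAdjoint g := cfc_predicate _ h
  have hcomm : Commute h g := by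
    have := cfc_commute_cfc (fun t : ℝ => t) (fun t : ℝ => (t + δ)⁻¹) h
    rwa [cfc_id' ℝ h] at this
  have h1 : 1 - h * g = cfc (fun t : ℝ => δ * (t + δ)⁻¹) h := by
    have e1 : h * g = cfc (fun t : ℝ => t * (t + δ)⁻¹) h := by
      rw [cfc_mul (fun t : ℝ => t) (fun t : ℝ => (t + δ)⁻¹) h, cfc_id' ℝ h]
    rw [e1, ← cfc_one ℝ h, ← cfc_sub (1 : ℝ → ℝ) (fun t : ℝ => t * (t + δ)⁻¹) h
      continuousOn_const (ContinuousOn.mul continuousOn_id hc)]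
    refine cfc_congr fun t ht => ?_
    have := hspec t ht
    have : t + δ ≠ 0 := by positivity
    simp only [Pi.one_apply]
    field_simp
    ring
  refine ⟨h * g, J.mul_mem_right _ (J.mul_mem_left _ hj), ?_, ?_, ?_⟩
  · rw [star_mul, hgsa.star_eq, hsa.star_eq, hcomm.eq]
  · rw [h1]
    refine norm_cfc_le zero_le_one fun t ht => ?_
    have := hspec t ht
    rw [Real.norm_of_nonneg (by positivity), ← div_eq_mul_inv, div_le_one (by positivity)]
    linarith
  · have h2 : star (j * (1 - h * g)) * (j * (1 - h * g)) =
        cfc (fun t : ℝ => δ * (t + δ)⁻¹ * t * (δ * (t + δ)⁻¹)) h := by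
      have hc2 : ContinuousOn (fun t : ℝ => δ * (t + δ)⁻¹) (spectrum ℝ h) :=
        ContinuousOn.mul (by fun_prop) hc
      have hsa2 : star (1 - h * g) = 1 - h * g := by
        rw [h1]; exact (cfc_predicate (p := IsSelfAdjoint) _ h : IsSelfAdjoint _).star_eq
      rw [star_mul, hsa2,
        cfc_mul (fun t : ℝ => δ * (t + δ)⁻¹ * t) (fun t : ℝ => δ * (t + δ)⁻¹) h
          (hc2.mul (by fun_prop)) hc2,
        cfc_mul (fun t : ℝ => δ * (t + δ)⁻¹) (fun t : ℝ => t) h hc2 (by fun_prop),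
        cfc_id' ℝ h, ← h1, hh]
      noncomm_ring
    have h3 : ‖j * (1 - h * g)‖ * ‖j * (1 - h * g)‖ ≤ ε * ε := by
      rw [← CStarRing.norm_star_mul_self, h2]
      refine norm_cfc_le (by positivity) fun t ht => ?_
      have := hspec t ht
      rw [Real.norm_of_nonneg (by positivity)]
      have h4 : δ * (t + δ)⁻¹ ≤ 1 := by
        rw [← div_eq_mul_inv, div_le_one (by positivity)]; linarith
      have h5 : (t + δ)⁻¹ * t ≤ 1 := by
        rw [mul_comm, ← div_eq_mul_inv, div_le_one (by positivity)]; linarith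
      calc δ * (t + δ)⁻¹ * t * (δ * (t + δ)⁻¹) = δ * ((t + δ)⁻¹ * t) * (δ * (t + δ)⁻¹) := by ring
        _ ≤ δ * 1 * 1 := by gcongr
        _ = ε * ε := by rw [hδdef]; ring
    exact abs_le_of_sq_le_sq' (by nlinarith) hε.le |>.2

/-- A closed two-sided ideal of a C*-algebra is self-adjoint. -/
theorem star_mem_of_isClosed (J : Ideal T) [J.IsTwoSided] (hJ : IsClosed (J : Set T)) {j : T}
    (hj : j ∈ J) : star j ∈ J := by
  rw [← SetLike.mem_coe, ← hJ.closure_eq, Metric.mem_closure_iff]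
  intro ε hε
  obtain ⟨e, heJ, hes, -, hje⟩ := exists_approx_unit J hj (half_pos hε)
  refine ⟨e * star j, J.mul_mem_right _ heJ, ?_⟩
  have : star j - e * star j = star (j * (1 - e)) := by
    rw [star_mul, star_sub, hes, star_one, sub_mul, one_mul]
  rw [dist_eq_norm, this, norm_star]
  linarith


/-- The quotient of a normed algebra by a closed two-sided ideal, with the quotient norm. -/
@[reducible]
noncomputable def quotientNormedRing (J : Ideal T) [J.IsTwoSided] (hJ : IsClosed (J : Set T)) :
    NormedRing (T ⧸ J) :=
  haveI : IsClosed (J : Set T) := hJ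
  { Submodule.Quotient.normedAddCommGroup J, Ideal.Quotient.ring J with
    dist_eq := dist_eq_norm_neg_add
    norm_mul_le := fun x y => by
      have key : ∀ ε : ℝ, 0 < ε → ‖x * y‖ ≤ (‖x‖ + ε) * (‖y‖ + ε) := by
        intro ε hε
        obtain ⟨a, rfl, ha⟩ := Submodule.Quotient.norm_mk_lt x hε
        obtain ⟨b, rfl, hb⟩ := Submodule.Quotient.norm_mk_lt y hε
        calc _ ≤ ‖a * b‖ := Submodule.Quotient.norm_mk_le J (a * b)
          _ ≤ ‖a‖ * ‖b‖ := norm_mul_le a b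
          _ ≤ _ := by gcongr
      have hlim : Filter.Tendsto (fun ε : ℝ => (‖x‖ + ε) * (‖y‖ + ε)) (nhdsWithin 0 (Set.Ioi 0))
          (nhds ((‖x‖ + 0) * (‖y‖ + 0))) :=
        (Continuous.tendsto (by fun_prop) 0).mono_left nhdsWithin_le_nhds
      rw [add_zero, add_zero] at hlim
      exact ge_of_tendsto hlim (by filter_upwards [self_mem_nhdsWithin] with ε hε using key ε hε) }

/-- The quotient of a C*-algebra by a closed two-sided ideal, with the quotient norm and the
quotient involution, is a C*-algebra. -/
@[reducible]
noncomputable def quotientCStarAlgebra (J : Ideal T) [J.IsTwoSided] (hJ : IsClosed (J : Set T)) :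
    CStarAlgebra (T ⧸ J) :=
  letI : NormedRing (T ⧸ J) := quotientNormedRing J hJ
  letI : NormedAlgebra ℂ (T ⧸ J) :=
    { Submodule.Quotient.normedSpace J ℂ, Ideal.Quotient.algebra ℂ with }
  letI : StarRing (T ⧸ J) :=
    { star := Quotient.map' star fun a b h => by
        rw [Submodule.quotientRel_def] at h ⊢
        rw [← star_sub]
        exact star_mem_of_isClosed J hJ h
      star_involutive := by rintro ⟨a⟩; exact congrArg (Ideal.Quotient.mk J) (star_star a)
      star_mul := by rintro ⟨a⟩ ⟨b⟩; exact congrArg (Ideal.Quotient.mk J) (star_mul a b)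
      star_add := by rintro ⟨a⟩ ⟨b⟩; exact congrArg (Ideal.Quotient.mk J) (star_add a b) }
  { (inferInstance : NormedRing (T ⧸ J)), (inferInstance : NormedAlgebra ℂ (T ⧸ J)),
    (inferInstance : StarRing (T ⧸ J)) with
    star_smul := by rintro c ⟨a⟩; exact congrArg (Ideal.Quotient.mk J) (star_smul c a)
    complete := (Submodule.Quotient.completeSpace J).complete
    norm_mul_self_le := by
      rintro ⟨a⟩
      refine le_of_forall_pos_le_add fun ε hε => ?_
      obtain ⟨m, hm, hmn⟩ :=
        Submodule.Quotient.norm_mk_lt (Ideal.Quotient.mk J (star a * a)) (half_pos hε)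
      have hj : star a * a - m ∈ J := (Submodule.Quotient.eq J).1 hm.symm
      obtain ⟨e, heJ, hes, he1, hje⟩ := exists_approx_unit J hj (half_pos hε)
      have hae : Ideal.Quotient.mk J a = Ideal.Quotient.mk J (a * (1 - e)) := by
        refine Ideal.Quotient.eq.2 ?_
        have : a - a * (1 - e) = a * e := by noncomm_ring
        rw [this]
        exact J.mul_mem_left _ heJ
      have h1 : ‖Ideal.Quotient.mk J a‖ ≤ ‖a * (1 - e)‖ := by
        rw [hae]; exact Submodule.Quotient.norm_mk_le J _
      have hs : star (1 - e) = 1 - e := by rw [star_sub, star_one, hes]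
      have h2 : ‖a * (1 - e)‖ * ‖a * (1 - e)‖ ≤ ‖star a * a * (1 - e)‖ := by
        rw [← CStarRing.norm_star_mul_self, star_mul, hs]
        calc ‖(1 - e) * star a * (a * (1 - e))‖ = ‖(1 - e) * (star a * a * (1 - e))‖ := by
              congr 1; noncomm_ring
          _ ≤ ‖1 - e‖ * ‖star a * a * (1 - e)‖ := norm_mul_le _ _
          _ ≤ 1 * ‖star a * a * (1 - e)‖ := by gcongr
          _ = _ := one_mul _
      have h3 : ‖star a * a * (1 - e)‖ ≤ ‖m‖ + ε / 2 := by
        calc ‖star a * a * (1 - e)‖ = ‖m * (1 - e) + (star a * a - m) * (1 - e)‖ := by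
              congr 1; noncomm_ring
          _ ≤ ‖m * (1 - e)‖ + ‖(star a * a - m) * (1 - e)‖ := norm_add_le _ _
          _ ≤ ‖m‖ * ‖1 - e‖ + ε / 2 := by gcongr; exact norm_mul_le _ _
          _ ≤ ‖m‖ * 1 + ε / 2 := by gcongr
          _ = _ := by rw [mul_one]
      have h4 : ‖Ideal.Quotient.mk J a‖ * ‖Ideal.Quotient.mk J a‖ ≤
          ‖a * (1 - e)‖ * ‖a * (1 - e)‖ := by gcongr
      change ‖Ideal.Quotient.mk J a‖ * ‖Ideal.Quotient.mk J a‖ ≤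
        ‖Ideal.Quotient.mk J (star a * a)‖ + ε
      linarith }
end CStarQuotient

/-! ### Approximately proper equivalence relations -/

/-- A pair `(ℛ, ℰ)` on the unital C*-algebra `A`: a decreasing sequence `R n` of closed unital
*-subalgebras with `R 0 = A`, and faithful conditional expectations `E n` of `A` onto `R n` with
`E (n+1) ∘ E n = E (n+1)`. -/
structure System (A : Type u) [CStarAlgebra A] where
  R : ℕ → StarSubalgebra ℂ A
  isClosed : ∀ n, IsClosed (R n : Set A)
  R_zero : R 0 = ⊤
  R_succ_le : ∀ n, R (n + 1) ≤ R n
  E : ∀ n, A →ₗ[ℂ] R n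
  isCondExp : ∀ n, IsConditionalExpectation (R n).subtype (E n)
  faithful : ∀ n (a : A), E n (star a * a) = 0 → a = 0
  compat : ∀ n (a : A), E (n + 1) (E n a : A) = E (n + 1) a

/-- A representation of the defining relations of the Toeplitz algebra in the unital C*-algebra
`B`: a unital *-homomorphism `φ : A → B` and projections `e n` in `B` such that `e 0 = 1`,
`e (n+1) e n = e (n+1)` and `e n φ(a) e n = φ(E n a) e n`. -/
structure ToeplitzRep {A : Type u} [CStarAlgebra A] (D : System A)
    (B : Type*) [CStarAlgebra B] where
  φ : A →⋆ₐ[ℂ] B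
  e : ℕ → B
  isStarProjection : ∀ n, IsStarProjection (e n)
  e_zero : e 0 = 1
  e_succ_mul : ∀ n, e (n + 1) * e n = e (n + 1)
  e_mul_mul : ∀ n (a : A), e n * φ a * e n = φ (D.E n a) * e n

/-- A representation of the relations in some nonzero C*-algebra in `Type u`. -/
structure SomeToeplitzRep {A : Type u} [CStarAlgebra A] (D : System A) : Type (u + 1) where
  B : Type u
  [cstar : CStarAlgebra B]
  [nontriv : Nontrivial B]
  rep : ToeplitzRep D B

attribute [instance] SomeToeplitzRep.cstar SomeToeplitzRep.nontriv

noncomputable instance {I : Type*} {A : I → Type*} [∀ i, Nontrivial (A i)]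
    [∀ i, CStarAlgebra (A i)] : CStarAlgebra (lp A ∞) where

namespace System

variable {A : Type u} [CStarAlgebra A] (D : System A)

/-- The C*-algebra of bounded families in the product of all representations. -/
abbrev RepProd : Type (u + 1) := lp (fun i : SomeToeplitzRep D => i.B) ∞

/-- The image of `a` in the product of all representations. -/
noncomputable def prodA : A →⋆ₐ[ℂ] D.RepProd where
  toFun a := ⟨fun i => i.rep.φ a, memℓp_infty ⟨‖a‖, by
    rintro _ ⟨i, rfl⟩; exact NonUnitalStarAlgHom.norm_apply_le i.rep.φ a⟩⟩
  map_one' := by ext i; exact map_one i.rep.φ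
  map_mul' a b := by ext i; exact map_mul i.rep.φ a b
  map_zero' := by ext i; exact map_zero i.rep.φ
  map_add' a b := by ext i; exact map_add i.rep.φ a b
  commutes' c := by ext i; exact i.rep.φ.toAlgHom.commutes c
  map_star' a := by ext i; exact map_star i.rep.φ a

/-- The image of the `n`-th generating projection in the product of all representations. -/
noncomputable def prodE (n : ℕ) : D.RepProd :=
  ⟨fun i => i.rep.e n, memℓp_infty ⟨1, by
    rintro _ ⟨i, rfl⟩; exact (i.rep.isStarProjection n).norm_le⟩⟩

/-- The Toeplitz algebra: the universal unital C*-algebra generated by `A` and projections `ê n`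
subject to the relations of `ToeplitzRep`.  It is realized as the C*-algebra generated by the
universal representation, the product of all representations.  (The C*-algebra generated by a
representation in any universe has a copy in `Type u`, so no representation is lost.) -/
noncomputable def toeplitzSubalgebra : StarSubalgebra ℂ D.RepProd :=
  (StarAlgebra.adjoin ℂ (Set.range D.prodA ∪ Set.range D.prodE)).topologicalClosure

/-- The Toeplitz algebra `𝒯(ℛ, ℰ)`. -/
abbrev Toeplitz : Type (u + 1) := D.toeplitzSubalgebra

noncomputable instance : CStarAlgebra D.Toeplitz :=
  StarSubalgebra.cstarAlgebra D.toeplitzSubalgebra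
    (h_closed := StarSubalgebra.isClosed_topologicalClosure _)

/-- The canonical map `A → 𝒯(ℛ, ℰ)`. -/
noncomputable def inclT : A →⋆ₐ[ℂ] D.Toeplitz :=
  D.prodA.codRestrict D.toeplitzSubalgebra fun a =>
    StarSubalgebra.le_topologicalClosure _
      (StarAlgebra.subset_adjoin ℂ _ (Or.inl (Set.mem_range_self a)))

/-- The canonical projections `ê n` of the Toeplitz algebra. -/
noncomputable def eT (n : ℕ) : D.Toeplitz :=
  ⟨D.prodE n, StarSubalgebra.le_topologicalClosure _
    (StarAlgebra.subset_adjoin ℂ _ (Or.inr (Set.mem_range_self n)))⟩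

/-- `𝒦̂ n`, the closed linear span of the elements `a ê n b` with `a, b` in `A`. -/
noncomputable def kT (n : ℕ) : Submodule ℂ D.Toeplitz :=
  (Submodule.span ℂ {x | ∃ a b : A, x = D.inclT a * D.eT n * D.inclT b}).topologicalClosure

/-- An `n`-redundancy: a tuple `(k 0, …, k n)` with `k i ∈ 𝒦̂ i` and `∑ k i x = 0` for all
`x ∈ 𝒦̂ n`. -/
structure IsRedundancy (n : ℕ) (k : Fin (n + 1) → D.Toeplitz) : Prop where
  mem : ∀ i : Fin (n + 1), k i ∈ D.kT i
  sum_mul : ∀ x ∈ D.kT n, ∑ i, k i * x = 0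

/-- The redundancy ideal: the closed two-sided ideal of the Toeplitz algebra generated by the
sums of all redundancies. -/
noncomputable def redundancyIdeal : Ideal D.Toeplitz :=
  sInf {J | J.IsTwoSided ∧ IsClosed (J : Set D.Toeplitz) ∧
    ∀ (n : ℕ) (k : Fin (n + 1) → D.Toeplitz), D.IsRedundancy n k → ∑ i, k i ∈ J}

instance : D.redundancyIdeal.IsTwoSided where
  mul_mem_of_left b ha := by
    rw [redundancyIdeal, Submodule.mem_sInf] at ha ⊢
    intro J hJ
    have := hJ.1
    exact Ideal.mul_mem_right b J (ha J hJ)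

theorem isClosed_redundancyIdeal : IsClosed (D.redundancyIdeal : Set D.Toeplitz) := by
  rw [redundancyIdeal, Submodule.coe_sInf]
  exact isClosed_biInter fun J hJ => hJ.2.1

/-- The C*-algebra `C*(ℛ, ℰ)`: the quotient of the Toeplitz algebra by the redundancy ideal. -/
def CStar : Type (u + 1) := D.Toeplitz ⧸ D.redundancyIdeal

noncomputable instance : CStarAlgebra D.CStar :=
  quotientCStarAlgebra D.redundancyIdeal D.isClosed_redundancyIdeal

/-- The quotient map `q : 𝒯(ℛ, ℰ) → C*(ℛ, ℰ)`. -/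
noncomputable def q : D.Toeplitz →⋆ₐ[ℂ] D.CStar where
  toFun := Ideal.Quotient.mk D.redundancyIdeal
  map_one' := rfl
  map_mul' _ _ := rfl
  map_zero' := rfl
  map_add' _ _ := rfl
  commutes' _ := rfl
  map_star' _ := rfl

/-- The canonical map `A → C*(ℛ, ℰ)`, by which `A` is regarded as a subalgebra. -/
noncomputable def incl : A →⋆ₐ[ℂ] D.CStar := D.q.comp D.inclT

/-- The projections `e n` in `C*(ℛ, ℰ)`. -/
noncomputable def e (n : ℕ) : D.CStar := D.q (D.eT n)

/-- The inclusion of `R (n+1)` into `R n`. -/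
noncomputable def inclR (n : ℕ) : D.R (n + 1) →⋆ₐ[ℂ] D.R n :=
  StarSubalgebra.inclusion (D.R_succ_le n)

/-- The restriction of `E (n+1)` to `R n`. -/
noncomputable def restrE (n : ℕ) : D.R n →ₗ[ℂ] D.R (n + 1) :=
  (D.E (n + 1)).comp (D.R n).subtype.toAlgHom.toLinearMap

/-- `λ n`, the index of the restriction of `E (n+1)` to `R n`, as an element of `A`. -/
noncomputable def lam (n : ℕ) : A := (index (D.inclR n) (D.restrE n) : D.R n)

/-- The product `(λ 0)⁻¹ ⋯ (λ (n-1))⁻¹` in `A`. -/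
noncomputable def lamInvProd (n : ℕ) : A :=
  ((List.range n).map fun i => Ring.inverse (D.lam i)).prod

end System

end ApproxProper

/-! With a quasi-basis (u, v) of E_n, a right R_n-linear map T on A is the sum of the operators x ↦
T(u_j) E_n(v_j x), so T should stand for Σ T(u_j) e_n v_j. Writing Λ_n = λ_0⁻¹⋯λ_{n-1}⁻¹, the only
candidate with the prescribed values is therefore G(T) = Σ T(u_j) Λ_n v_j. Because Λ_n commutes with
R_n, this does not depend on the quasi-basis (`basisForm_eq`). It does not depend on n either: a
quasi-basis (p, q) of E_{n+1} on R_n refines (u, v), and Σ p_s q_s = λ_n cancels the new factor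
λ_n⁻¹ (`basisForm_comp`). Complete positivity of E_n gives G(T*T) ≥ 0 (`exists_basisForm_self`).

To pass to C*(ℛ, ℰ), each state φ of A is used in a GNS construction: the form φ(G(x*y)) on
eventually right linear maps is completed to a Hilbert space, on which A acts by left multiplication
and e_n by composition with E_n. The Toeplitz relations hold, and Σ u_i e_n v_i acts as 1, so
redundancies act as 0 and the representation descends to the quotient. The vector functional of the
identity map sends a e_n b to φ(a Λ_n b).

Monomials a e_n b span a dense subspace, and states detect norm (up to a factor 2) and positivity in
A. These functionals, for all φ, therefore glue to one bounded positive A-bimodule map G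
(`exists_conditionalExpectation`). If A is commutative, applying any conditional expectation to Σ
u_i e_n v_i = 1 shows that its value at e_n is the inverse of Σ u_i v_i, whence uniqueness. -/

namespace ApproxProper

/-! ### Positivity in C*-algebras, complete positivity of expectations, and invertibility of the
index. -/

section CStarLemmas

variable {B C : Type*} [CStarAlgebra B] [CStarAlgebra C]

/-- A sum of elements of the form `y* y` vanishes only if all the `y` vanish. -/
theorem eq_zero_of_sum_star_mul_self_add {ι : Type*} (s : Finset ι) (z : ι → B) {y : B}
    (h : star y * y + ∑ p ∈ s, star (z p) * z p = 0) : ∀ p ∈ s, z p = 0 := by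
  let _ : PartialOrder B := CStarAlgebra.spectralOrder B
  let _ : StarOrderedRing B := CStarAlgebra.spectralOrderedRing B
  intro p hp
  have h0 : ∀ q ∈ s, 0 ≤ star (z q) * z q := fun q _ => star_mul_self_nonneg _
  have h1 : ∑ q ∈ s, star (z q) * z q = 0 :=
    ((add_eq_zero_iff_of_nonneg (star_mul_self_nonneg y) (Finset.sum_nonneg h0)).1 h).2
  exact CStarRing.star_mul_self_eq_zero_iff _ |>.1 ((Finset.sum_eq_zero_iff_of_nonneg h0).1 h1 p hp)

/-- A sum of elements of the form `y* y` is again of this form. -/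
theorem exists_sum_star_mul_self {ι : Type*} (s : Finset ι) (z : ι → B) :
    ∃ y, ∑ p ∈ s, star (z p) * z p = star y * y := by
  let _ : PartialOrder B := CStarAlgebra.spectralOrder B
  let _ : StarOrderedRing B := CStarAlgebra.spectralOrderedRing B
  exact CStarAlgebra.nonneg_iff_eq_star_mul_self.1
    (Finset.sum_nonneg fun q _ => star_mul_self_nonneg (z q))

/-- The negative part of a self-adjoint element of a C*-algebra. -/
theorem exists_negPart (M : B) (hsa : IsSelfAdjoint M) :
    ∃ N s : B, N = star s * s ∧ star N = N ∧ N * M = - (N * N) ∧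
      (N = 0 → ∃ d, M = star d * d) := by
  let _ : PartialOrder B := CStarAlgebra.spectralOrder B
  let _ : StarOrderedRing B := CStarAlgebra.spectralOrderedRing B
  have hN0 : 0 ≤ M⁻ := CFC.negPart_nonneg M
  obtain ⟨s, hs⟩ := CStarAlgebra.nonneg_iff_eq_star_mul_self.1 hN0
  refine ⟨M⁻, s, hs, (IsSelfAdjoint.of_nonneg hN0).star_eq, ?_, fun h => ?_⟩
  · nth_rw 2 [← CFC.posPart_sub_negPart M hsa]
    rw [mul_sub, CFC.negPart_mul_posPart, zero_sub]
  · refine CStarAlgebra.nonneg_iff_eq_star_mul_self.1 ?_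
    rw [← CFC.posPart_sub_negPart M hsa, h, sub_zero]
    exact CFC.posPart_nonneg M

/-- A self-adjoint matrix over a C*-algebra all of whose values `∑ b k* M k l b l` are positive is
of the form `d* d`. -/
theorem exists_eq_star_mul_self_of_forall {m : ℕ} (M : CStarMatrix (Fin m) (Fin m) C)
    (hsa : star M = M)
    (hM : ∀ b : Fin m → C, ∃ y, ∑ k, ∑ l, star (b k) * M k l * b l = star y * y) :
    ∃ d : CStarMatrix (Fin m) (Fin m) C, M = star d * d := by
  let _ : PartialOrder C := CStarAlgebra.spectralOrder C
  let _ : StarOrderedRing C := CStarAlgebra.spectralOrderedRing C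
  obtain ⟨N, s, hs, hNsa, hNM, hd⟩ := exists_negPart M hsa
  have hNM : N * M * N = - (star (s * N) * (s * N)) := by
    rw [hNM, star_mul, hNsa, neg_mul, mul_assoc, mul_assoc]
    congr 2
    rw [← mul_assoc, ← hs]
  have hsN : s * N = 0 := by
    ext p j
    -- Test on the columns of `N`: the diagonal entry of `N * M * N` is `star y * y`, and also minus
    -- a sum of squares, so every square vanishes.
    obtain ⟨y, hy⟩ := hM fun k => N k j
    have e1 : (N * M * N) j j = ∑ k, ∑ l, star (N k j) * M k l * N l j := by
      simp only [CStarMatrix.mul_apply, Finset.sum_mul]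
      rw [Finset.sum_comm]
      refine Finset.sum_congr rfl fun k _ => Finset.sum_congr rfl fun l _ => ?_
      rw [← CStarMatrix.star_apply, hNsa]
    have e2 : (star (s * N) * (s * N)) j j = ∑ p, star ((s * N) p j) * (s * N) p j := by
      simp only [CStarMatrix.mul_apply (M := star (s * N)), CStarMatrix.star_apply]
    refine eq_zero_of_sum_star_mul_self_add Finset.univ (fun p => (s * N) p j) (y := y) ?_ p
      (Finset.mem_univ p)
    rw [← hy, ← e1, ← e2, hNM]
    simp
  refine hd ?_
  rw [← CStarRing.star_mul_self_eq_zero_iff N, hNsa]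
  nth_rw 1 [hs]
  rw [mul_assoc, hsN, mul_zero]

variable {ι : C →⋆ₐ[ℂ] B} {E : B →ₗ[ℂ] C}

namespace IsConditionalExpectation

theorem map_one (h : IsConditionalExpectation ι E) : E 1 = 1 := by
  simpa using h.apply_incl 1

/-- For self-adjoint y, both y² and (1 + y)² = 1 + 2y + y² have self-adjoint images, hence so does
2y. -/
theorem map_star (h : IsConditionalExpectation ι E) (x : B) : E (star x) = star (E x) := by
  have hp : ∀ y : B, star (E (star y * y)) = E (star y * y) := fun y => by
    obtain ⟨z, hz⟩ := h.positive y
    rw [hz, star_mul, star_star]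
  have hs : ∀ y : B, star y = y → star (E y) = E y := fun y hy => by
    have h1 := hp (1 + y)
    have h2 := hp y
    simp only [star_add, star_one, hy, add_mul, mul_add, one_mul, mul_one, map_add,
      h.map_one] at h1 h2
    rw [h2] at h1
    have h3 : (2 : ℂ) • (star (E y) - E y) = 0 := by
      rw [two_smul, ← sub_eq_zero.2 h1]
      abel
    exact sub_eq_zero.1 ((smul_eq_zero.1 h3).resolve_left two_ne_zero)
  have hr := hs (realPart x) (realPart x).2
  have hi := hs (imaginaryPart x) (imaginaryPart x).2
  rw [← realPart_add_I_smul_imaginaryPart x, star_add, star_smul, map_add, map_add, map_smul,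
    map_smul, star_add, star_smul, hr, hi, (realPart x).2.star_eq, (imaginaryPart x).2.star_eq]

/-- The Gram matrix `E (a k* a l)` is of the form `d* d`; that is, `E` is completely positive. -/
theorem exists_gram (h : IsConditionalExpectation ι E) {m : ℕ} (a : Fin m → B) :
    ∃ d : Fin m → Fin m → C, ∀ k l, E (star (a k) * a l) = ∑ p, star (d p k) * d p l := by
  let M : CStarMatrix (Fin m) (Fin m) C := CStarMatrix.ofMatrix fun k l => E (star (a k) * a l)
  have hMa : ∀ k l, M k l = E (star (a k) * a l) := fun _ _ => rfl
  obtain ⟨d, hd⟩ := exists_eq_star_mul_self_of_forall M (by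
    ext k l
    rw [CStarMatrix.star_apply, hMa, hMa, ← h.map_star, star_mul, star_star]) (fun b => by
      -- By the bimodule property, the Gram matrix tested on b is E(z*z) with z = Σ a_l b_l.
      obtain ⟨y, hy⟩ := h.positive (∑ l, a l * ι (b l))
      refine ⟨y, hy ▸ ?_⟩
      simp only [star_sum, Finset.sum_mul, Finset.mul_sum, map_sum, star_mul, hMa]
      rw [Finset.sum_comm]
      refine Finset.sum_congr rfl fun k _ => Finset.sum_congr rfl fun l _ => ?_
      rw [← StarHomClass.map_star, ← mul_assoc, h.map_mul_incl, mul_assoc (ι _),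
        h.map_incl_mul])
  refine ⟨fun p k => d p k, fun k l => ?_⟩
  rw [← hMa, hd, CStarMatrix.mul_apply]
  simp only [CStarMatrix.star_apply]

end IsConditionalExpectation

namespace IsQuasiBasis

variable {k : ℕ} {u v : Fin k → B}

/-- Expand b u_i by the left identity, then collect the coefficients E(v_j b u_i) v_i into v_j b by
the right one. -/
theorem index_mul_comm (hq : IsQuasiBasis ι E u v) (b : B) :
    b * ∑ i, u i * v i = (∑ i, u i * v i) * b := by
  calc b * ∑ i, u i * v i = ∑ i, (∑ j, u j * ι (E (v j * (b * u i)))) * v i := by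
        simp_rw [hq.sum_left, Finset.mul_sum, mul_assoc]
    _ = ∑ j, u j * ∑ i, ι (E (v j * b * u i)) * v i := by
        simp_rw [Finset.mul_sum, Finset.sum_mul, mul_assoc]
        exact Finset.sum_comm
    _ = (∑ i, u i * v i) * b := by simp_rw [hq.sum_right, Finset.sum_mul, mul_assoc]

/-- This is the adjoint of `sum_right` at `star (u i)`. It brings in the Gram matrix of u, which can
then be factored as d*d. -/
theorem left_eq (hE : IsConditionalExpectation ι E) (hq : IsQuasiBasis ι E u v) (i : Fin k) :
    ∑ j, star (v j) * ι (E (star (u j) * u i)) = u i := by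
  have := congrArg star (hq.sum_right (star (u i)))
  rw [star_sum, star_star] at this
  refine Eq.trans (Finset.sum_congr rfl fun j _ => ?_) this
  rw [star_mul, ← StarHomClass.map_star ι, ← hE.map_star, star_mul, star_star]

/-- The index is a sum of elements `w* w`, and `1 = ∑ w* r` for suitable `r`. -/
theorem exists_index_eq (hE : IsConditionalExpectation ι E) (hq : IsQuasiBasis ι E u v) :
    ∃ w r : Fin k → B, ∑ i, u i * v i = ∑ p, star (w p) * w p ∧ 1 = ∑ p, star (w p) * r p := by
  obtain ⟨d, hd⟩ := hE.exists_gram u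
  -- Since u = v*(d*d), the sum Σ u_i x_i is the pairing of dv with dx. Taking x = v gives the
  -- index; taking x_i = E(v_i) gives 1.
  have key : ∀ x : Fin k → B, ∑ i, u i * x i =
      ∑ p, star (∑ j, ι (d p j) * v j) * ∑ i, ι (d p i) * x i := fun x => by
    calc ∑ i, u i * x i = ∑ i, (∑ j, star (v j) * ι (E (star (u j) * u i))) * x i := by
          simp_rw [hq.left_eq hE]
      _ = _ := by
          simp only [hd, map_sum, map_mul, StarHomClass.map_star, star_sum, star_mul, Finset.mul_sum,
            Finset.sum_mul, Finset.mul_sum]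
          symm
          rw [Finset.sum_comm]
          refine Finset.sum_congr rfl fun i _ => ?_
          rw [Finset.sum_comm]
          simp only [mul_assoc]
  refine ⟨fun p => ∑ j, ι (d p j) * v j, fun p => ∑ i, ι (d p i) * ι (E (v i)), key v, ?_⟩
  rw [← key]
  simpa using (hq.sum_left 1).symm

theorem exists_index_eq_star_mul_self (hE : IsConditionalExpectation ι E)
    (hq : IsQuasiBasis ι E u v) : ∃ y, ∑ i, u i * v i = star y * y := by
  obtain ⟨w, -, hw, -⟩ := hq.exists_index_eq hE
  rw [hw]
  exact exists_sum_star_mul_self _ _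

/-- From 1 = Σ w*r, expanding 0 ≤ Σ (Kw − r)*(Kw − r) gives 2K ≤ K²·ind + Σ r*r. Once K > 0
dominates Σ r*r, this leaves K ≤ K²·ind, so the index is bounded below by a positive scalar. -/
theorem isUnit_index (hE : IsConditionalExpectation ι E) (hq : IsQuasiBasis ι E u v) :
    IsUnit (∑ i, u i * v i) := by
  let _ : PartialOrder B := CStarAlgebra.spectralOrder B
  let _ : StarOrderedRing B := CStarAlgebra.spectralOrderedRing B
  rcases subsingleton_or_nontrivial B with _ | _
  · exact isUnit_of_subsingleton _
  obtain ⟨w, r, hw, hr⟩ := hq.exists_index_eq hE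
  rw [hw]
  have hr' : 1 = ∑ p, star (r p) * w p := by
    simpa [star_sum] using congrArg star hr
  set K : ℝ := ‖∑ p, star (r p) * r p‖ + 1 with hK
  have hK0 : 0 < K := by positivity
  have h1 : ∑ p, star (r p) * r p ≤ algebraMap ℝ B K :=
    (IsSelfAdjoint.le_algebraMap_norm_self (.of_nonneg (Finset.sum_nonneg fun p _ =>
      star_mul_self_nonneg (r p)))).trans (algebraMap_le_algebraMap.2 (by linarith))
  have h2 : 0 ≤ ∑ p, star (K • w p - r p) * (K • w p - r p) :=
    Finset.sum_nonneg fun p _ => star_mul_self_nonneg _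
  have h3 : ∑ p, star (K • w p - r p) * (K • w p - r p) =
      (K * K) • ∑ p, star (w p) * w p - (2 * K) • 1 + ∑ p, star (r p) * r p := by
    have : (2 * K) • (1 : B) = K • ∑ p, star (w p) * r p + K • ∑ p, star (r p) * w p := by
      rw [← hr, ← hr', two_mul, add_smul]
    rw [this]
    simp only [star_sub, star_smul, star_trivial, sub_mul, mul_sub, smul_mul_assoc, mul_smul_comm,
      smul_sub, smul_smul, Finset.sum_sub_distrib, Finset.smul_sum]
    abel
  have h4 : algebraMap ℝ B K ≤ (K * K) • ∑ p, star (w p) * w p := by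
    rw [h3] at h2
    have h5 := add_le_add h2 h1
    have h6 : (2 * K) • (1 : B) = algebraMap ℝ B K + algebraMap ℝ B K := by
      rw [Algebra.algebraMap_eq_smul_one, ← add_smul, two_mul]
    rw [h6, ← sub_nonneg] at h5
    rw [← sub_nonneg]
    convert h5 using 1
    abel
  have h7 : IsUnit ((K * K) • ∑ p, star (w p) * w p) :=
    CStarAlgebra.isUnit_of_le _ h4 ((isStrictlyPositive_algebraMap hK0))
  have h8 := h7.smul (Units.mk0 (K * K)⁻¹ (by positivity))
  rwa [Units.smul_mk0, smul_smul, inv_mul_cancel₀ (by positivity), one_smul] at h8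

end IsQuasiBasis

end CStarLemmas

/-! ### The tower of expectations on A and the elements λ_n. -/

namespace System

variable {A : Type u} [CStarAlgebra A] (D : System A)

/-- The closed subalgebra `R n` is a C*-algebra. -/
noncomputable abbrev cstarAlgebraR (n : ℕ) : CStarAlgebra (D.R n) :=
  StarSubalgebra.cstarAlgebra (D.R n) (h_closed := D.isClosed n)

theorem R_antitone : Antitone D.R := antitone_nat_of_succ_le D.R_succ_le

/-- The conditional expectation `E n` as a map from `A` to `A`. -/
noncomputable def expect (n : ℕ) : A →ₗ[ℂ] A := (D.R n).subtype.toAlgHom.toLinearMap ∘ₗ D.E n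

theorem coe_E (n : ℕ) (a : A) : (D.E n a : A) = D.expect n a := rfl

theorem expect_mem (n : ℕ) (a : A) : D.expect n a ∈ D.R n := (D.E n a).2

variable {D}

theorem expect_of_mem {n : ℕ} {r : A} (hr : r ∈ D.R n) : D.expect n r = r :=
  congrArg Subtype.val ((D.isCondExp n).apply_incl ⟨r, hr⟩)

theorem expect_mul_left {n : ℕ} {r : A} (hr : r ∈ D.R n) (a : A) :
    D.expect n (r * a) = r * D.expect n a :=
  congrArg Subtype.val ((D.isCondExp n).map_incl_mul ⟨r, hr⟩ a)

theorem expect_mul_right {n : ℕ} {r : A} (hr : r ∈ D.R n) (a : A) :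
    D.expect n (a * r) = D.expect n a * r :=
  congrArg Subtype.val ((D.isCondExp n).map_mul_incl a ⟨r, hr⟩)

theorem expect_star (n : ℕ) (a : A) : D.expect n (star a) = star (D.expect n a) :=
  letI := D.cstarAlgebraR n
  congrArg Subtype.val ((D.isCondExp n).map_star a)

theorem expect_zero (a : A) : D.expect 0 a = a :=
  expect_of_mem (by rw [D.R_zero]; trivial)

theorem expect_expect {m n : ℕ} (h : m ≤ n) (a : A) :
    D.expect n (D.expect m a) = D.expect n a := by
  induction n, h using Nat.le_induction with
  | base => exact expect_of_mem (D.expect_mem m a)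
  | succ n _ ih =>
    have hc : ∀ b, D.expect (n + 1) (D.expect n b) = D.expect (n + 1) b := fun b =>
      congrArg Subtype.val (D.compat n b)
    rw [← hc, ih, hc]

variable (D)

theorem isConditionalExpectation_restrE (n : ℕ) :
    IsConditionalExpectation (D.inclR n) (D.restrE n) where
  apply_incl c := (D.isCondExp (n + 1)).apply_incl c
  map_incl_mul c x := (D.isCondExp (n + 1)).map_incl_mul c x
  map_mul_incl x c := (D.isCondExp (n + 1)).map_mul_incl x c
  positive x := (D.isCondExp (n + 1)).positive x

/-- A quasi-basis of E_{n+1} on A is pushed into R_n by E_n: for x in R_n, apply E_n to the two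
expansions of x and use E_{n+1} E_n = E_{n+1}. -/
theorem isIndexFinite_restrE (n : ℕ) (h : IsIndexFinite (D.R (n + 1)).subtype (D.E (n + 1))) :
    IsIndexFinite (D.inclR n) (D.restrE n) := by
  obtain ⟨k, u, v, hq⟩ := h
  refine ⟨k, fun i => D.E n (u i), fun i => D.E n (v i), fun x => ?_, fun x => ?_⟩
  · refine Subtype.ext ?_
    have h1 := congrArg (D.expect n) (hq.sum_left x)
    rw [expect_of_mem x.2, map_sum] at h1
    refine Eq.trans ?_ h1
    rw [AddSubmonoidClass.coe_finsetSum]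
    refine Finset.sum_congr rfl fun i _ => ?_
    change D.expect n (u i) * D.expect (n + 1) (D.expect n (v i) * x) =
      D.expect n (u i * D.expect (n + 1) (v i * x))
    rw [expect_mul_right (D.R_succ_le n (D.expect_mem _ _)), ← expect_mul_right x.2,
      expect_expect n.le_succ]
  · refine Subtype.ext ?_
    have h1 := congrArg (D.expect n) (hq.sum_right x)
    rw [expect_of_mem x.2, map_sum] at h1
    refine Eq.trans ?_ h1
    rw [AddSubmonoidClass.coe_finsetSum]
    refine Finset.sum_congr rfl fun i _ => ?_
    change D.expect (n + 1) (x * D.expect n (u i)) * D.expect n (v i) =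
      D.expect n (D.expect (n + 1) (x * u i) * v i)
    rw [expect_mul_left (D.R_succ_le n (D.expect_mem _ _)), ← expect_mul_left x.2,
      expect_expect n.le_succ]

theorem lam_mem (n : ℕ) : D.lam n ∈ D.R n := (index (D.inclR n) (D.restrE n)).2

/-- The standing assumption of finite index. -/
abbrev FiniteIndex : Prop := ∀ n, IsIndexFinite (D.R n).subtype (D.E n)

variable {D}

theorem FiniteIndex.lam_props (hfin : D.FiniteIndex) (n : ℕ) :
    (∀ r ∈ D.R n, Commute (D.lam n) r) ∧ (∃ y, D.lam n = star y * y) ∧ IsUnit (D.lam n) := by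
  let _ := D.cstarAlgebraR n
  let _ := D.cstarAlgebraR (n + 1)
  obtain ⟨k, u, v, hq⟩ := D.isIndexFinite_restrE n (hfin (n + 1))
  have hE := D.isConditionalExpectation_restrE n
  rw [lam, hq.index_eq]
  refine ⟨fun r hr => ?_, ?_, ?_⟩
  · exact (congrArg Subtype.val (hq.index_mul_comm ⟨r, hr⟩)).symm
  · obtain ⟨y, hy⟩ := hq.exists_index_eq_star_mul_self hE
    exact ⟨y, congrArg Subtype.val hy⟩
  · exact (hq.isUnit_index hE).map (D.R n).subtype

theorem FiniteIndex.lam_comm (hfin : D.FiniteIndex) {n : ℕ} {r : A} (hr : r ∈ D.R n) :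
    Commute (D.lam n) r := (hfin.lam_props n).1 r hr

theorem FiniteIndex.isUnit_lam (hfin : D.FiniteIndex) (n : ℕ) : IsUnit (D.lam n) :=
  (hfin.lam_props n).2.2

theorem commute_inverse_of_commute {a b : A} (h : Commute a b) : Commute (Ring.inverse a) b := by
  by_cases ha : IsUnit a
  · obtain ⟨w, rfl⟩ := ha
    rw [Ring.inverse_unit]
    exact h.units_inv_left
  · rw [Ring.inverse_non_unit _ ha]
    exact Commute.zero_left b

theorem lamInvProd_zero : D.lamInvProd 0 = 1 := by simp [lamInvProd]

theorem lamInvProd_succ (n : ℕ) :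
    D.lamInvProd (n + 1) = D.lamInvProd n * Ring.inverse (D.lam n) := by
  simp [lamInvProd, List.range_succ]

/-- Each factor comes from some λ_i with i < n, which commutes with R_i ⊇ R_n. -/
theorem FiniteIndex.lamInvProd_comm (hfin : D.FiniteIndex) {n : ℕ} {r : A} (hr : r ∈ D.R n) :
    Commute (D.lamInvProd n) r := by
  induction n with
  | zero => rw [lamInvProd_zero]; exact Commute.one_left r
  | succ n ih =>
    rw [lamInvProd_succ]
    exact (ih (D.R_succ_le n hr)).mul_left
      (commute_inverse_of_commute (hfin.lam_comm (D.R_succ_le n hr)))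

/-- The factors are positive and commute: λ_n lies in R_n, hence commutes with the product of the
earlier ones. -/
theorem FiniteIndex.exists_lamInvProd_eq (hfin : D.FiniteIndex) (n : ℕ) :
    ∃ y, D.lamInvProd n = star y * y := by
  let _ : PartialOrder A := CStarAlgebra.spectralOrder A
  let _ : StarOrderedRing A := CStarAlgebra.spectralOrderedRing A
  refine CStarAlgebra.nonneg_iff_eq_star_mul_self.1 ?_
  induction n with
  | zero => rw [lamInvProd_zero]; exact zero_le_one
  | succ n ih =>
    rw [lamInvProd_succ]
    refine Commute.mul_nonneg ih ?_
      (commute_inverse_of_commute (hfin.lamInvProd_comm (D.lam_mem n)).symm).symm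
    obtain ⟨-, ⟨y, hy⟩, hu⟩ := hfin.lam_props n
    have hsa : IsSelfAdjoint (D.lam n) := hy ▸ IsSelfAdjoint.star_mul_self y
    have h1 : Ring.inverse (D.lam n) = star (Ring.inverse (D.lam n)) * D.lam n *
        Ring.inverse (D.lam n) := by
      rw [hsa.ringInverse.star_eq, Ring.inverse_mul_cancel _ hu, one_mul]
    rw [h1]
    exact star_left_conjugate_nonneg (hy ▸ star_mul_self_nonneg y) _

end System

/-! ### The A-valued form at level n, its positivity, and its compatibility with level n + 1. -/

namespace System

variable {A : Type u} [CStarAlgebra A] (D : System A)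

/-- A quasi-basis of the conditional expectation `E n`, with any finite index type. -/
structure IsBasis (n : ℕ) {ι : Type*} [Fintype ι] (u v : ι → A) : Prop where
  left : ∀ x, ∑ i, u i * D.expect n (v i * x) = x
  right : ∀ x, ∑ i, D.expect n (x * u i) * v i = x

/-- A linear map `A → A` is right `R n`-linear. -/
def IsRightLinear (n : ℕ) (x : A →ₗ[ℂ] A) : Prop := ∀ a, ∀ r ∈ D.R n, x (a * r) = x a * r

/-- The adjoint, with respect to the `R n`-valued inner product `E n (a* b)`, of a right
`R n`-linear map, computed by means of a quasi-basis. -/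
noncomputable def adj (n : ℕ) {ι : Type*} [Fintype ι] (u v : ι → A) (x : A →ₗ[ℂ] A) (b : A) : A :=
  ∑ i, star (v i) * D.expect n (star (x (u i)) * b)

/-- The `A`-valued form `(x, y) ↦ G (x* y)` computed by means of a quasi-basis. -/
noncomputable def basisForm (n : ℕ) {ι : Type*} [Fintype ι] (u v : ι → A) (x y : A →ₗ[ℂ] A) : A :=
  ∑ j, D.adj n u v x (y (u j)) * D.lamInvProd n * v j

variable {D} {n : ℕ} {ι κ : Type*} [Fintype ι] [Fintype κ] {u v : ι → A} {u' v' : κ → A}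

theorem adj_eq (h : D.IsBasis n u v) (h' : D.IsBasis n u' v') {x : A →ₗ[ℂ] A}
    (hx : D.IsRightLinear n x) (b : A) : D.adj n u v x b = D.adj n u' v' x b := by
  have h1 : ∀ i, x (u i) = ∑ k, x (u' k) * D.expect n (v' k * u i) := fun i => by
    conv_lhs => rw [← h'.left (u i), map_sum]
    exact Finset.sum_congr rfl fun k _ => hx _ _ (D.expect_mem _ _)
  have h2 : ∀ k, ∑ i, star (v i) * star (D.expect n (v' k * u i)) = star (v' k) := fun k => by
    conv_rhs => rw [← h.right (v' k), star_sum]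
    simp only [star_mul]
  simp only [adj]
  calc ∑ i, star (v i) * D.expect n (star (x (u i)) * b)
      = ∑ i, ∑ k, star (v i) * star (D.expect n (v' k * u i)) *
          D.expect n (star (x (u' k)) * b) := by
        refine Finset.sum_congr rfl fun i _ => ?_
        rw [h1, star_sum, Finset.sum_mul, map_sum, Finset.mul_sum]
        refine Finset.sum_congr rfl fun k _ => ?_
        rw [star_mul, mul_assoc, expect_mul_left (star_mem (D.expect_mem _ _)), mul_assoc]
    _ = _ := by
        rw [Finset.sum_comm]
        simp_rw [← Finset.sum_mul, h2]

/-- The transition coefficients E_n(v'_k u_j) lie in R_n, so they pass through Λ_n from the u side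
to the v side, where they are absorbed. -/
theorem basisForm_eq (h : D.IsBasis n u v) (h' : D.IsBasis n u' v') (hfin : D.FiniteIndex)
    {x y : A →ₗ[ℂ] A} (hx : D.IsRightLinear n x) (hy : D.IsRightLinear n y) :
    D.basisForm n u v x y = D.basisForm n u' v' x y := by
  have hr : ∀ (b : A) (r : A), r ∈ D.R n →
      D.adj n u' v' x (b * r) = D.adj n u' v' x b * r := fun b r hr => by
    simp only [adj, Finset.sum_mul, ← mul_assoc]
    exact Finset.sum_congr rfl fun i _ => by rw [expect_mul_right hr, mul_assoc]
  have hs : ∀ {ν : Type _} (s : Finset ν) (f : ν → A),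
      D.adj n u' v' x (∑ k ∈ s, f k) = ∑ k ∈ s, D.adj n u' v' x (f k) := fun s f => by
    simp only [adj, Finset.mul_sum, map_sum]
    exact Finset.sum_comm
  simp only [basisForm]
  calc ∑ j, D.adj n u v x (y (u j)) * D.lamInvProd n * v j
      = ∑ j, ∑ k, D.adj n u' v' x (y (u' k)) * D.lamInvProd n *
          (D.expect n (v' k * u j) * v j) := by
        refine Finset.sum_congr rfl fun j _ => ?_
        rw [adj_eq h h' hx]
        conv_lhs => rw [← h'.left (u j), map_sum, hs, Finset.sum_mul, Finset.sum_mul]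
        refine Finset.sum_congr rfl fun k _ => ?_
        rw [hy _ _ (D.expect_mem _ _), hr _ _ (D.expect_mem _ _), mul_assoc _ _ (D.lamInvProd n),
          ← (hfin.lamInvProd_comm (D.expect_mem n _)).eq]
        simp only [mul_assoc]
    _ = _ := by
        rw [Finset.sum_comm]
        simp_rw [← Finset.mul_sum, h.right]

/-- The form takes positive values on the diagonal. -/
theorem exists_basisForm_self {k : ℕ} (u v : Fin k → A) (hfin : D.FiniteIndex)
    (x : A →ₗ[ℂ] A) : ∃ z, D.basisForm n u v x x = star z * z := by
  let _ := D.cstarAlgebraR n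
  -- The Gram matrix is factored over `R n` rather than over `A`, so that the entries of d commute
  -- with Λ_n = c*c; the form becomes Σ_p z_p* z_p with z_p = Σ_i c d_pi v_i.
  obtain ⟨d, hd⟩ := (D.isCondExp n).exists_gram fun i => x (u i)
  obtain ⟨c, hc⟩ := hfin.exists_lamInvProd_eq n
  have hd' : ∀ i j, D.expect n (star (x (u i)) * x (u j)) =
      ∑ p, star (d p i : A) * (d p j : A) := fun i j => by
    rw [← coe_E, hd, AddSubmonoidClass.coe_finsetSum]
    rfl
  obtain ⟨z, hz⟩ := exists_sum_star_mul_self Finset.univ fun p => ∑ i, c * (d p i * v i : A)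
  refine ⟨z, hz ▸ ?_⟩
  have ht : ∀ i j, star (v i) * D.expect n (star (x (u i)) * x (u j)) * D.lamInvProd n * v j =
      ∑ p, star (c * (d p i * v i : A)) * (c * (d p j * v j : A)) := fun i j => by
    rw [hd', Finset.mul_sum, Finset.sum_mul, Finset.sum_mul]
    refine Finset.sum_congr rfl fun p _ => ?_
    calc star (v i) * (star (d p i : A) * (d p j : A)) * D.lamInvProd n * v j
        = star (v i) * star (d p i : A) * ((d p j : A) * D.lamInvProd n) * v j := by
          simp only [mul_assoc]
      _ = _ := by
          rw [← (hfin.lamInvProd_comm (d p j).2).eq, hc]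
          simp only [star_mul, mul_assoc]
  simp only [basisForm, adj, Finset.sum_mul, ht, star_sum]
  rw [Finset.sum_comm]
  symm
  rw [Finset.sum_comm]
  refine Finset.sum_congr rfl fun i _ => ?_
  simp only [Finset.mul_sum]
  exact Finset.sum_comm

/-- Coefficients of an expansion over E_n lie in R_n and are expanded again by (p, q). -/
theorem isBasis_comp {k l : ℕ} {u v : Fin k → A} (h : D.IsBasis n u v) {p q : Fin l → D.R n}
    (hpq : IsQuasiBasis (D.inclR n) (D.restrE n) p q) :
    D.IsBasis (n + 1) (fun i : Fin k × Fin l => u i.1 * p i.2)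
      (fun i : Fin k × Fin l => (q i.2 : A) * v i.1) := by
  have hl : ∀ r ∈ D.R n, ∑ s, (p s : A) * D.expect (n + 1) (q s * r) = r := fun r hr => by
    have := congrArg Subtype.val (hpq.sum_left ⟨r, hr⟩)
    rwa [AddSubmonoidClass.coe_finsetSum] at this
  have hr : ∀ r ∈ D.R n, ∑ s, D.expect (n + 1) (r * p s) * (q s : A) = r := fun r hr => by
    have := congrArg Subtype.val (hpq.sum_right ⟨r, hr⟩)
    rwa [AddSubmonoidClass.coe_finsetSum] at this
  refine ⟨fun x => ?_, fun x => ?_⟩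
  · rw [Fintype.sum_prod_type]
    conv_rhs => rw [← h.left x]
    refine Finset.sum_congr rfl fun i _ => ?_
    rw [← hl _ (D.expect_mem n (v i * x)), Finset.mul_sum]
    refine Finset.sum_congr rfl fun s _ => ?_
    rw [← expect_mul_left (q s).2, expect_expect n.le_succ]
    simp only [mul_assoc]
  · rw [Fintype.sum_prod_type]
    conv_rhs => rw [← h.right x]
    refine Finset.sum_congr rfl fun i _ => ?_
    rw [← hr _ (D.expect_mem n (x * u i)), Finset.sum_mul]
    refine Finset.sum_congr rfl fun s _ => ?_
    rw [← expect_mul_right (p s).2, expect_expect n.le_succ]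
    simp only [mul_assoc]

/-- The adjoint is the same at both levels. Moving p_s past Λ_{n+1} by right linearity and
commutation produces Σ p_s q_s = λ_n, which cancels the last factor of Λ_{n+1}. This is where the
values λ_i⁻¹ are needed. -/
theorem basisForm_comp {k l : ℕ} {u v : Fin k → A} {p q : Fin l → D.R n}
    (hpq : IsQuasiBasis (D.inclR n) (D.restrE n) p q) (hfin : D.FiniteIndex)
    {x y : A →ₗ[ℂ] A} (hx : D.IsRightLinear n x) (hy : D.IsRightLinear n y) :
    D.basisForm (n + 1) (fun i : Fin k × Fin l => u i.1 * p i.2)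
      (fun i : Fin k × Fin l => (q i.2 : A) * v i.1) x y = D.basisForm n u v x y := by
  have hr : ∀ r ∈ D.R n, ∑ s, D.expect (n + 1) (r * p s) * (q s : A) = r := fun r hr => by
    have := congrArg Subtype.val (hpq.sum_right ⟨r, hr⟩)
    rwa [AddSubmonoidClass.coe_finsetSum] at this
  have hl : ∀ r ∈ D.R n, ∑ s, star (q s : A) * D.expect (n + 1) (star (p s : A) * r) = r :=
    fun r h => by
      have := congrArg star (hr (star r) (star_mem h))
      rw [star_sum, star_star] at this
      refine Eq.trans (Finset.sum_congr rfl fun s _ => ?_) this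
      rw [star_mul, ← expect_star, star_mul, star_star]
  have hadj : ∀ b, D.adj (n + 1) (fun i : Fin k × Fin l => u i.1 * p i.2)
      (fun i : Fin k × Fin l => (q i.2 : A) * v i.1) x b = D.adj n u v x b := fun b => by
    simp only [adj]
    rw [Fintype.sum_prod_type]
    refine Finset.sum_congr rfl fun i _ => ?_
    rw [← hl _ (D.expect_mem n (star (x (u i)) * b)), Finset.mul_sum]
    refine Finset.sum_congr rfl fun s _ => ?_
    rw [← expect_mul_left (star_mem (p s).2), expect_expect n.le_succ, hx _ _ (p s).2]
    simp only [star_mul, mul_assoc]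
  have hadj' : ∀ b : A, ∀ r ∈ D.R n, D.adj n u v x (b * r) = D.adj n u v x b * r :=
    fun b r hr => by
      simp only [adj, Finset.sum_mul, ← mul_assoc]
      exact Finset.sum_congr rfl fun i _ => by rw [expect_mul_right hr, mul_assoc]
  have hlam : ∑ s, (p s : A) * (q s : A) = D.lam n := by
    rw [lam, hpq.index_eq, AddSubmonoidClass.coe_finsetSum]
    rfl
  simp only [basisForm, hadj]
  rw [Fintype.sum_prod_type]
  refine Finset.sum_congr rfl fun j _ => ?_
  calc ∑ s, D.adj n u v x (y (u j * p s)) * D.lamInvProd (n + 1) * (q s * v j)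
      = ∑ s, D.adj n u v x (y (u j)) * D.lamInvProd n * Ring.inverse (D.lam n) *
          (p s * q s) * v j := by
        refine Finset.sum_congr rfl fun s _ => ?_
        rw [hy _ _ (p s).2, hadj' _ _ (p s).2, lamInvProd_succ, mul_assoc _ (p s : A),
          ← mul_assoc (p s : A), ← (hfin.lamInvProd_comm (p s).2).eq, mul_assoc _ (p s : A),
          ← (commute_inverse_of_commute (hfin.lam_comm (p s).2)).eq]
        simp only [mul_assoc]
    _ = _ := by
        rw [← Finset.sum_mul, ← Finset.mul_sum, hlam, mul_assoc _ (Ring.inverse _),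
          Ring.inverse_mul_cancel _ (hfin.isUnit_lam n), mul_one]

end System

/-! ### Symmetries of the form, and its extension to the union over all levels. -/

namespace System

variable {A : Type u} [CStarAlgebra A] {D : System A} {n : ℕ} {ι : Type*} [Fintype ι] {u v : ι → A}

theorem basisForm_star (hfin : D.FiniteIndex) (x y : A →ₗ[ℂ] A) :
    star (D.basisForm n u v x y) = D.basisForm n u v y x := by
  obtain ⟨c, hc⟩ := hfin.exists_lamInvProd_eq n
  have hsa : star (D.lamInvProd n) = D.lamInvProd n := by rw [hc, star_mul, star_star]
  simp only [basisForm, adj, Finset.sum_mul, star_sum]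
  rw [Finset.sum_comm]
  refine Finset.sum_congr rfl fun i _ => Finset.sum_congr rfl fun j _ => ?_
  rw [star_mul, star_mul, star_mul, ← expect_star, star_star, star_mul, star_star, hsa,
    mul_assoc (star _) _ (D.lamInvProd n), ← (hfin.lamInvProd_comm (D.expect_mem n _)).eq]
  simp only [mul_assoc]

theorem basisForm_add_right (x y z : A →ₗ[ℂ] A) :
    D.basisForm n u v x (y + z) = D.basisForm n u v x y + D.basisForm n u v x z := by
  simp only [basisForm, adj, LinearMap.add_apply, mul_add, map_add, Finset.sum_add_distrib, add_mul]

theorem basisForm_smul_right (c : ℂ) (x y : A →ₗ[ℂ] A) :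
    D.basisForm n u v x (c • y) = c • D.basisForm n u v x y := by
  simp only [basisForm, adj, LinearMap.smul_apply, mul_smul_comm, map_smul, ← Finset.smul_sum,
    smul_mul_assoc]

theorem basisForm_mulLeft (a : A) (x y : A →ₗ[ℂ] A) :
    D.basisForm n u v (LinearMap.mulLeft ℂ a ∘ₗ x) y =
      D.basisForm n u v x (LinearMap.mulLeft ℂ (star a) ∘ₗ y) := by
  simp only [basisForm, adj, LinearMap.comp_apply, LinearMap.mulLeft_apply, star_mul, mul_assoc]

/-- E_m is symmetric for the inner product E_n(a*b) when m ≤ n: both sides equal E_n(E_m(a)*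
E_m(b)). -/
theorem basisForm_expect {m : ℕ} (h : m ≤ n) (x y : A →ₗ[ℂ] A) :
    D.basisForm n u v (D.expect m ∘ₗ x) y = D.basisForm n u v x (D.expect m ∘ₗ y) := by
  have key : ∀ a b : A, D.expect n (star (D.expect m a) * b) =
      D.expect n (star a * D.expect m b) := fun a b => by
    rw [← expect_expect h, expect_mul_left (star_mem (D.expect_mem _ _)), ← expect_star,
      ← expect_mul_right (D.expect_mem _ _), expect_expect h]
  simp only [basisForm, adj, LinearMap.comp_apply, key]

/-- The operator x ↦ a E_n(b x) represents a e_n b, so this is the prescribed value of G on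
monomials. -/
theorem basisForm_id (h : D.IsBasis n u v) (hfin : D.FiniteIndex) (a b : A) :
    D.basisForm n u v LinearMap.id
      (LinearMap.mulLeft ℂ a ∘ₗ D.expect n ∘ₗ LinearMap.mulLeft ℂ b) =
      a * D.lamInvProd n * b := by
  have hl : ∀ x, ∑ i, star (v i) * D.expect n (star (u i) * x) = x := fun x => by
    conv_rhs => rw [← star_star x, ← h.right (star x), star_sum]
    refine Finset.sum_congr rfl fun s _ => ?_
    rw [star_mul, ← expect_star, star_mul, star_star]
  simp only [basisForm, adj, LinearMap.comp_apply, LinearMap.mulLeft_apply, LinearMap.id_apply, hl]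
  calc ∑ i, a * D.expect n (b * u i) * D.lamInvProd n * v i
      = ∑ i, a * D.lamInvProd n * (D.expect n (b * u i) * v i) := by
        refine Finset.sum_congr rfl fun i _ => ?_
        rw [mul_assoc a, ← (hfin.lamInvProd_comm (D.expect_mem n _)).eq]
        simp only [mul_assoc]
    _ = _ := by rw [← Finset.mul_sum, h.right]

theorem IsRightLinear.mono {m : ℕ} {x : A →ₗ[ℂ] A} (hx : D.IsRightLinear n x) (h : n ≤ m) :
    D.IsRightLinear m x := fun a r hr => hx a r (D.R_antitone h hr)

theorem IsRightLinear.mulLeft_comp {x : A →ₗ[ℂ] A} (hx : D.IsRightLinear n x) (a : A) :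
    D.IsRightLinear n (LinearMap.mulLeft ℂ a ∘ₗ x) := fun b r hr => by
  simp only [LinearMap.comp_apply, LinearMap.mulLeft_apply, hx b r hr, mul_assoc]

theorem IsRightLinear.expect_comp {m : ℕ} {x : A →ₗ[ℂ] A} (hx : D.IsRightLinear n x) (h : m ≤ n) :
    D.IsRightLinear n (D.expect m ∘ₗ x) := fun b r hr => by
  simp only [LinearMap.comp_apply, hx b r hr, expect_mul_right (D.R_antitone h hr)]

theorem isRightLinear_id : D.IsRightLinear n LinearMap.id := fun _ _ _ => rfl

/-- The form `(x, y) ↦ G (x* y)` on the right `R n`-linear maps. -/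
noncomputable def FiniteIndex.levelForm (hfin : D.FiniteIndex) (n : ℕ) (x y : A →ₗ[ℂ] A) : A :=
  D.basisForm n (hfin n).choose_spec.choose (hfin n).choose_spec.choose_spec.choose x y

theorem isBasis_of_isQuasiBasis {k : ℕ} {u v : Fin k → A}
    (h : IsQuasiBasis (D.R n).subtype (D.E n) u v) : D.IsBasis n u v :=
  ⟨h.sum_left, h.sum_right⟩

theorem FiniteIndex.levelForm_eq (hfin : D.FiniteIndex) (h : D.IsBasis n u v) {x y : A →ₗ[ℂ] A}
    (hx : D.IsRightLinear n x) (hy : D.IsRightLinear n y) :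
    hfin.levelForm n x y = D.basisForm n u v x y :=
  basisForm_eq (isBasis_of_isQuasiBasis (hfin n).choose_spec.choose_spec.choose_spec) h hfin hx hy

/-- Level m + 1 may be computed in the composite quasi-basis, which reduces it to level m. -/
theorem FiniteIndex.levelForm_of_le (hfin : D.FiniteIndex) {x y : A →ₗ[ℂ] A}
    (hx : D.IsRightLinear n x) (hy : D.IsRightLinear n y) {m : ℕ} (h : n ≤ m) :
    hfin.levelForm m x y = hfin.levelForm n x y := by
  induction m, h using Nat.le_induction with
  | base => rfl
  | succ m h ih =>
    rw [← ih]
    obtain ⟨k, u, v, hq⟩ := hfin m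
    obtain ⟨l, p, q, hpq⟩ := D.isIndexFinite_restrE m (hfin (m + 1))
    have hb := isBasis_of_isQuasiBasis hq
    rw [hfin.levelForm_eq (isBasis_comp hb hpq) (hx.mono (h.trans m.le_succ))
      (hy.mono (h.trans m.le_succ)), basisForm_comp hpq hfin (hx.mono h) (hy.mono h),
      hfin.levelForm_eq hb (hx.mono h) (hy.mono h)]

variable (D) in
/-- The union of the algebras of right `R n`-linear maps. -/
noncomputable def eventuallyLinear : Submodule ℂ (A →ₗ[ℂ] A) where
  carrier := {x | ∃ n, D.IsRightLinear n x}
  zero_mem' := ⟨0, fun _ _ _ => by simp⟩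
  add_mem' := by
    rintro x y ⟨m, hx⟩ ⟨n, hy⟩
    refine ⟨max m n, fun a r hr => ?_⟩
    simp only [LinearMap.add_apply, hx.mono (le_max_left m n) a r hr,
      hy.mono (le_max_right m n) a r hr, add_mul]
  smul_mem' := by
    rintro c x ⟨n, hx⟩
    exact ⟨n, fun a r hr => by simp only [LinearMap.smul_apply, hx a r hr, smul_mul_assoc]⟩

/-- The form `(x, y) ↦ G (x* y)` on the union of the algebras of right `R n`-linear maps. -/
noncomputable def FiniteIndex.form (hfin : D.FiniteIndex) (x y : D.eventuallyLinear) : A :=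
  hfin.levelForm (max x.2.choose y.2.choose) x y

theorem FiniteIndex.form_eq (hfin : D.FiniteIndex) {x y : D.eventuallyLinear}
    (hx : D.IsRightLinear n x.1) (hy : D.IsRightLinear n y.1) :
    hfin.form x y = hfin.levelForm n x y := by
  have hx' := x.2.choose_spec
  have hy' := y.2.choose_spec
  rcases le_total n (max x.2.choose y.2.choose) with h | h
  · exact hfin.levelForm_of_le hx hy h
  · exact (hfin.levelForm_of_le (hx'.mono (le_max_left _ _)) (hy'.mono (le_max_right _ _)) h).symm

theorem exists_isRightLinear (s : Finset D.eventuallyLinear) :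
    ∃ n, ∀ x ∈ s, D.IsRightLinear n x.1 := by
  classical
  induction s using Finset.induction_on with
  | empty => exact ⟨0, by simp⟩
  | insert x s _ ih =>
    obtain ⟨n, hn⟩ := ih
    obtain ⟨m, hm⟩ := x.2
    refine ⟨max m n, fun y hy => ?_⟩
    rcases Finset.mem_insert.1 hy with rfl | hy
    · exact hm.mono (le_max_left _ _)
    · exact (hn y hy).mono (le_max_right _ _)

theorem FiniteIndex.form_star (hfin : D.FiniteIndex) (x y : D.eventuallyLinear) :
    star (hfin.form x y) = hfin.form y x := by
  classical
  obtain ⟨n, hn⟩ := exists_isRightLinear {x, y}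
  rw [hfin.form_eq (hn x (by simp)) (hn y (by simp)), hfin.form_eq (hn y (by simp)) (hn x (by simp))]
  exact basisForm_star hfin _ _

theorem FiniteIndex.form_add_right (hfin : D.FiniteIndex) (x y z : D.eventuallyLinear) :
    hfin.form x (y + z) = hfin.form x y + hfin.form x z := by
  classical
  obtain ⟨n, hn⟩ := exists_isRightLinear {x, y, z, y + z}
  rw [hfin.form_eq (hn x (by simp)) (hn y (by simp)), hfin.form_eq (hn x (by simp)) (hn z (by simp)),
    hfin.form_eq (hn x (by simp)) (hn (y + z) (by simp))]
  exact basisForm_add_right _ _ _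

theorem FiniteIndex.form_smul_right (hfin : D.FiniteIndex) (c : ℂ) (x y : D.eventuallyLinear) :
    hfin.form x (c • y) = c • hfin.form x y := by
  classical
  obtain ⟨n, hn⟩ := exists_isRightLinear {x, y, c • y}
  rw [hfin.form_eq (hn x (by simp)) (hn y (by simp)),
    hfin.form_eq (hn x (by simp)) (hn (c • y) (by simp))]
  exact basisForm_smul_right _ _ _

theorem FiniteIndex.exists_form_self (hfin : D.FiniteIndex) (x : D.eventuallyLinear) :
    ∃ z, hfin.form x x = star z * z :=
  exists_basisForm_self _ _ hfin _

variable (D) in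
/-- Left multiplication by `a` on the eventually linear maps. -/
noncomputable def leftMul (a : A) : D.eventuallyLinear →ₗ[ℂ] D.eventuallyLinear where
  toFun x := ⟨LinearMap.mulLeft ℂ a ∘ₗ x.1, x.2.imp fun _ h => h.mulLeft_comp a⟩
  map_add' _ _ := Subtype.ext (LinearMap.comp_add _ _ _)
  map_smul' _ _ := Subtype.ext (LinearMap.comp_smul _ _ _)

variable (D) in
/-- Composition with `E n` on the eventually linear maps. -/
noncomputable def leftExpect (n : ℕ) : D.eventuallyLinear →ₗ[ℂ] D.eventuallyLinear where
  toFun x := ⟨D.expect n ∘ₗ x.1, by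
    obtain ⟨m, hm⟩ := x.2
    exact ⟨max m n, (hm.mono (le_max_left m n)).expect_comp (le_max_right m n)⟩⟩
  map_add' _ _ := Subtype.ext (LinearMap.comp_add _ _ _)
  map_smul' _ _ := Subtype.ext (LinearMap.comp_smul _ _ _)

theorem FiniteIndex.form_leftMul (hfin : D.FiniteIndex) (a : A) (x y : D.eventuallyLinear) :
    hfin.form (D.leftMul a x) y = hfin.form x (D.leftMul (star a) y) := by
  classical
  obtain ⟨n, hn⟩ := exists_isRightLinear {x, y}
  have hx := hn x (by simp)
  have hy := hn y (by simp)
  rw [hfin.form_eq (x := D.leftMul a x) (hx.mulLeft_comp a) hy,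
    hfin.form_eq (y := D.leftMul (star a) y) hx (hy.mulLeft_comp (star a))]
  exact basisForm_mulLeft _ _ _

theorem FiniteIndex.form_leftExpect (hfin : D.FiniteIndex) (m : ℕ) (x y : D.eventuallyLinear) :
    hfin.form (D.leftExpect m x) y = hfin.form x (D.leftExpect m y) := by
  classical
  obtain ⟨n, hn⟩ := exists_isRightLinear {x, y}
  have hx := (hn x (by simp)).mono (le_max_left n m)
  have hy := (hn y (by simp)).mono (le_max_left n m)
  rw [hfin.form_eq (x := D.leftExpect m x) (hx.expect_comp (le_max_right n m)) hy,
    hfin.form_eq (y := D.leftExpect m y) hx (hy.expect_comp (le_max_right n m))]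
  exact basisForm_expect (le_max_right n m) _ _

variable (D) in
/-- The identity map as an eventually linear map. -/
noncomputable def idVec : D.eventuallyLinear := ⟨LinearMap.id, 0, isRightLinear_id⟩

theorem FiniteIndex.form_idVec (hfin : D.FiniteIndex) (n : ℕ) (a b : A) :
    hfin.form D.idVec (D.leftMul a (D.leftExpect n (D.leftMul b D.idVec))) =
      a * D.lamInvProd n * b := by
  rw [hfin.form_eq (n := n) (x := D.idVec) isRightLinear_id
    (((isRightLinear_id.mulLeft_comp b).expect_comp le_rfl).mulLeft_comp a)]
  exact basisForm_id (isBasis_of_isQuasiBasis (hfin n).choose_spec.choose_spec.choose_spec) hfin a b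

end System

/-! ### States determine positivity and control the norm. -/

section States

variable {A : Type*} [CStarAlgebra A]

/-- A state: a positive unital linear functional. -/
structure IsState (φ : A →ₗ[ℂ] ℂ) : Prop where
  map_one : φ 1 = 1
  positive : ∀ y : A, ∃ r : ℝ, 0 ≤ r ∧ φ (star y * y) = r

/-- A state is a conditional expectation onto the scalars. -/
theorem IsState.map_star {φ : A →ₗ[ℂ] ℂ} (h : IsState φ) (x : A) :
    φ (star x) = star (φ x) := by
  have hι : ∀ c, StarAlgHom.ofId ℂ A c = algebraMap ℂ A c := fun _ => rfl
  have hc : IsConditionalExpectation (StarAlgHom.ofId ℂ A) φ :=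
    { apply_incl := fun c => by
        rw [hι, Algebra.algebraMap_eq_smul_one, map_smul, h.map_one, smul_eq_mul, mul_one]
      map_incl_mul := fun c x => by
        rw [hι, ← Algebra.smul_def, map_smul, smul_eq_mul]
      map_mul_incl := fun x c => by
        rw [hι, ← Algebra.commutes, ← Algebra.smul_def, map_smul, smul_eq_mul, mul_comm]
      positive := fun x => by
        obtain ⟨r, hr, hx⟩ := h.positive x
        refine ⟨(Real.sqrt r : ℂ), hx.trans ?_⟩
        rw [Complex.star_def, Complex.conj_ofReal, ← Complex.ofReal_mul, Real.mul_self_sqrt hr] }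
  exact hc.map_star x

/-- A unital contractive functional is a state. -/
theorem isState_of_norm_le {φ : A →ₗ[ℂ] ℂ} (h1 : φ 1 = 1) (hn : ∀ x, ‖φ x‖ ≤ ‖x‖) :
    IsState φ := by
  refine ⟨h1, fun y => ?_⟩
  let _ : PartialOrder A := CStarAlgebra.spectralOrder A
  let _ : StarOrderedRing A := CStarAlgebra.spectralOrderedRing A
  have h0 : 0 ≤ star y * y := star_mul_self_nonneg y
  have hsa : star (star y * y) = star y * y := by rw [star_mul, star_star]
  generalize star y * y = h at h0 hsa
  have halg : ∀ c : ℂ, φ (algebraMap ℂ A c) = c := fun c => by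
    rw [Algebra.algebraMap_eq_smul_one, map_smul, h1, smul_eq_mul, mul_one]
  have hre : 0 ≤ (φ h).re := by
    have h2 : ‖algebraMap ℝ A ‖h‖ - h‖ ≤ ‖h‖ := by
      rw [CStarAlgebra.norm_le_iff_le_algebraMap _ (norm_nonneg _)
        (sub_nonneg.2 (IsSelfAdjoint.le_algebraMap_norm_self hsa))]
      exact sub_le_self _ h0
    have h3 := (hn _).trans h2
    rw [map_sub, show algebraMap ℝ A ‖h‖ = algebraMap ℂ A (‖h‖ : ℂ) from
      IsScalarTower.algebraMap_apply ℝ ℂ A _, halg] at h3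
    have h4 := (Complex.re_le_norm _).trans h3
    rw [Complex.sub_re, Complex.ofReal_re] at h4
    linarith
  have him : (φ h).im = 0 := by
    -- Contractivity at h + is. The s² terms cancel, leaving a bound on a term linear in s, which
    -- forces its coefficient 2 Im φ(h) to vanish.
    have key : ∀ s : ℝ, (φ h).re ^ 2 + ((φ h).im + s) ^ 2 ≤ ‖h‖ ^ 2 + s ^ 2 := fun s => by
      have e1 : star (h + algebraMap ℂ A (s * Complex.I)) * (h + algebraMap ℂ A (s * Complex.I)) =
          h * h + algebraMap ℂ A (s ^ 2) := by
        rw [star_add, hsa, ← algebraMap_star_comm, add_mul, mul_add, mul_add,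
          ← Algebra.commutes (s * Complex.I) h, ← map_mul]
        have : star (s * Complex.I : ℂ) = -(s * Complex.I) := by simp
        rw [this, map_neg, neg_mul, add_assoc, add_neg_cancel_left]
        congr 2
        linear_combination -(s : ℂ) ^ 2 * Complex.I_sq
      have e2 : ‖h + algebraMap ℂ A (s * Complex.I)‖ ^ 2 ≤ ‖h‖ ^ 2 + s ^ 2 := by
        rw [sq, ← CStarRing.norm_star_mul_self, e1]
        refine (norm_add_le _ _).trans (add_le_add ?_ ?_)
        · rw [sq]; exact norm_mul_le _ _
        · rcases subsingleton_or_nontrivial A with _ | _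
          · rw [Subsingleton.elim (algebraMap ℂ A (s ^ 2)) 0, norm_zero]; positivity
          · rw [norm_algebraMap']
            simp
      have e3 : ‖φ (h + algebraMap ℂ A (s * Complex.I))‖ ^ 2 ≤ ‖h‖ ^ 2 + s ^ 2 :=
        (pow_le_pow_left₀ (norm_nonneg _) (hn _) 2).trans e2
      rw [map_add, halg, ← Complex.normSq_eq_norm_sq, Complex.normSq_apply] at e3
      simp only [Complex.add_re, Complex.add_im, Complex.mul_re, Complex.mul_im, Complex.ofReal_re,
        Complex.ofReal_im, Complex.I_re, Complex.I_im] at e3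
      nlinarith
    by_contra hne
    have h5 := key ((‖h‖ ^ 2 + 1) / (2 * (φ h).im))
    have h6 : 2 * (φ h).im * ((‖h‖ ^ 2 + 1) / (2 * (φ h).im)) = ‖h‖ ^ 2 + 1 := by
      field_simp
    nlinarith [sq_nonneg (φ h).re, sq_nonneg (φ h).im]
  exact ⟨_, hre, Complex.ext rfl (by simp [him])⟩

/-- Every spectral value of a self-adjoint element is attained at some state. -/
theorem exists_isState_apply_eq {a : A} (ha : IsSelfAdjoint a) {t : ℝ} (ht : t ∈ spectrum ℝ a) :
    ∃ φ : A →ₗ[ℂ] ℂ, IsState φ ∧ φ a = t := by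
  have : IsStarNormal a := ha.isStarNormal
  let x : StarAlgebra.elemental ℂ a := ⟨a, StarAlgebra.elemental.self_mem ℂ a⟩
  have hx : (t : ℂ) ∈ spectrum ℂ x := by
    have h1 : (t : ℂ) ∈ spectrum ℂ a := by
      rw [← spectrum.preimage_algebraMap ℂ] at ht
      exact ht
    exact AlgHom.spectrum_apply_subset (StarAlgebra.elemental ℂ a).subtype.toAlgHom x h1
  -- A character of the commutative algebra generated by `a` takes the value t at `a`; its
  -- Hahn–Banach extension is unital and contractive, hence a state.
  obtain ⟨χ, hχ⟩ := WeakDual.CharacterSpace.mem_spectrum_iff_exists.1 hx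
  let f : StrongDual ℂ (StarAlgebra.elemental ℂ a).toSubalgebra.toSubmodule :=
    LinearMap.mkContinuous
      { toFun := fun y => χ y
        map_add' := fun y z => map_add χ y z
        map_smul' := fun c y => map_smul χ c y } 1
      fun y => by rw [one_mul]; exact NonUnitalStarAlgHom.norm_apply_le (A := StarAlgebra.elemental ℂ a) χ y
  obtain ⟨g, hg, hgn⟩ := exists_extension_norm_eq _ f
  have hf1 : ‖f‖ ≤ 1 := LinearMap.mkContinuous_norm_le _ zero_le_one _
  refine ⟨g.toLinearMap, isState_of_norm_le ?_ fun y => ?_, ?_⟩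
  · exact (hg ⟨1, one_mem (StarAlgebra.elemental ℂ a)⟩).trans (map_one χ)
  · exact (g.le_of_opNorm_le (hgn.le.trans hf1) y).trans_eq (one_mul _)
  · exact (hg x).trans hχ

theorem eq_zero_of_forall_isState {a : A} (ha : ∀ φ : A →ₗ[ℂ] ℂ, IsState φ → φ a = 0) : a = 0 := by
  have key : ∀ b : A, IsSelfAdjoint b → (∀ φ : A →ₗ[ℂ] ℂ, IsState φ → φ b = 0) → b = 0 := by
    intro b hb h
    refine CFC.eq_zero_of_spectrum_subset_zero (R := ℝ) (p := IsSelfAdjoint) b (fun t ht => ?_) hb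
    obtain ⟨φ, hφ, ht⟩ := exists_isState_apply_eq hb ht
    rw [h φ hφ] at ht
    exact_mod_cast ht.symm
  rw [← realPart_add_I_smul_imaginaryPart a, key _ (realPart a).2, key _ (imaginaryPart a).2,
    smul_zero, add_zero]
  · intro φ hφ
    simp [imaginaryPart_apply_coe, hφ.map_star, ha φ hφ]
  · intro φ hφ
    simp [realPart_apply_coe, hφ.map_star, ha φ hφ]

theorem exists_eq_star_mul_self_of_forall_isState {a : A}
    (ha : ∀ φ : A →ₗ[ℂ] ℂ, IsState φ → ∃ r : ℝ, 0 ≤ r ∧ φ a = r) : ∃ y, a = star y * y := by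
  let _ : PartialOrder A := CStarAlgebra.spectralOrder A
  let _ : StarOrderedRing A := CStarAlgebra.spectralOrderedRing A
  have hsa : IsSelfAdjoint a := by
    refine sub_eq_zero.1 (eq_zero_of_forall_isState fun φ hφ => ?_)
    obtain ⟨r, -, hr⟩ := ha φ hφ
    simp [hφ.map_star, hr]
  refine CStarAlgebra.nonneg_iff_eq_star_mul_self.1 ?_
  rw [StarOrderedRing.nonneg_iff_spectrum_nonneg (R := ℝ) a hsa]
  intro t ht
  obtain ⟨φ, hφ, ht⟩ := exists_isState_apply_eq hsa ht
  obtain ⟨r, hr0, hr⟩ := ha φ hφ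
  rw [hr] at ht
  exact_mod_cast (Complex.ofReal_injective ht) ▸ hr0

/-- The factor 2 comes from bounding the real and imaginary parts separately; it is harmless, since
only continuity of G is wanted. -/
theorem norm_le_of_forall_isState {a : A} {c : ℝ}
    (ha : ∀ φ : A →ₗ[ℂ] ℂ, IsState φ → ‖φ a‖ ≤ c) (hc : 0 ≤ c) : ‖a‖ ≤ 2 * c := by
  have key : ∀ b : A, IsSelfAdjoint b → (∀ φ : A →ₗ[ℂ] ℂ, IsState φ → ‖φ b‖ ≤ c) → ‖b‖ ≤ c := by
    intro b hb h
    rw [← cfc_id' ℝ b hb]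
    refine norm_cfc_le hc fun t ht => ?_
    obtain ⟨φ, hφ, ht⟩ := exists_isState_apply_eq hb ht
    have := h φ hφ
    rwa [ht, Complex.norm_real] at this
  have hs : ∀ φ : A →ₗ[ℂ] ℂ, IsState φ → ‖φ (star a)‖ ≤ c := fun φ hφ => by
    rw [hφ.map_star, norm_star]; exact ha φ hφ
  rw [← realPart_add_I_smul_imaginaryPart a]
  refine (norm_add_le _ _).trans ?_
  rw [two_mul]
  refine add_le_add (key _ (realPart a).2 fun φ hφ => ?_) ?_
  · rw [realPart_apply_coe, LinearMap.map_smul_of_tower, map_add, norm_smul,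
      Real.norm_of_nonneg (by norm_num)]
    linarith [norm_add_le (φ a) (φ (star a)), hs φ hφ, ha φ hφ]
  · rw [norm_smul, Complex.norm_I, one_mul]
    refine key _ (imaginaryPart a).2 fun φ hφ => ?_
    rw [imaginaryPart_apply_coe, map_smul, norm_smul, norm_neg, Complex.norm_I, one_mul,
      LinearMap.map_smul_of_tower, map_sub, norm_smul, Real.norm_of_nonneg (by norm_num)]
    linarith [norm_sub_le (φ a) (φ (star a)), hs φ hφ, ha φ hφ]

end States

/-! ### The GNS representation attached to a state of A. -/

namespace System

open UniformSpace Completion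

variable {A : Type u} [CStarAlgebra A] {D : System A}

/-- The eventually linear maps with the semi-inner product given by the form and a state. -/
def FormSpace (_hfin : D.FiniteIndex) {φ : A →ₗ[ℂ] ℂ} (_hφ : IsState φ) : Type u :=
  D.eventuallyLinear

namespace FormSpace

variable {hfin : D.FiniteIndex} {φ : A →ₗ[ℂ] ℂ} {hφ : IsState φ}

noncomputable instance : AddCommGroup (FormSpace hfin hφ) :=
  inferInstanceAs (AddCommGroup D.eventuallyLinear)

noncomputable instance : Module ℂ (FormSpace hfin hφ) :=
  inferInstanceAs (Module ℂ D.eventuallyLinear)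

/-- The form of two vectors, as an element of `A`. -/
noncomputable def aform (x y : FormSpace hfin hφ) : A := hfin.form x y

theorem aform_star (x y : FormSpace hfin hφ) : star (aform x y) = aform y x := hfin.form_star x y

theorem aform_add_right (x y z : FormSpace hfin hφ) :
    aform x (y + z) = aform x y + aform x z := hfin.form_add_right x y z

theorem aform_smul_right (c : ℂ) (x y : FormSpace hfin hφ) :
    aform x (c • y) = c • aform x y := hfin.form_smul_right c x y

/-- The semi-inner product `φ (form x y)`. -/
noncomputable abbrev core : PreInnerProductSpace.Core ℂ (FormSpace hfin hφ) where
  inner x y := φ (aform x y)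
  conj_inner_symm x y := by
    rw [← Complex.star_def, ← hφ.map_star, aform_star]
  re_inner_nonneg x := by
    obtain ⟨z, hz⟩ := hfin.exists_form_self x
    obtain ⟨r, hr, hrz⟩ := hφ.positive z
    have : φ (aform x x) = r := (congrArg φ hz).trans hrz
    rw [this]
    simpa using hr
  add_left x y z := by
    rw [← aform_star, aform_add_right, star_add, aform_star, aform_star, map_add]
  smul_left x y c := by
    rw [← aform_star, aform_smul_right, star_smul, aform_star, map_smul]
    rfl

noncomputable instance : SeminormedAddCommGroup (FormSpace hfin hφ) :=
  InnerProductSpace.Core.toSeminormedAddCommGroup (c := core)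

noncomputable instance : InnerProductSpace ℂ (FormSpace hfin hφ) :=
  InnerProductSpace.ofCore core

theorem inner_def (x y : FormSpace hfin hφ) : inner ℂ x y = φ (aform x y) := rfl

theorem norm_sq_eq (x : FormSpace hfin hφ) : ‖x‖ ^ 2 = (φ (aform x x)).re := by
  rw [← inner_def]
  exact (inner_self_eq_norm_sq (𝕜 := ℂ) x).symm

/-- Left multiplication by an element of `A`. -/
noncomputable def lmul (a : A) : FormSpace hfin hφ →ₗ[ℂ] FormSpace hfin hφ where
  toFun x := D.leftMul a x
  map_add' := (D.leftMul a).map_add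
  map_smul' := (D.leftMul a).map_smul

/-- Composition with the conditional expectation `E n`. -/
noncomputable def lexp (n : ℕ) : FormSpace hfin hφ →ₗ[ℂ] FormSpace hfin hφ where
  toFun x := D.leftExpect n x
  map_add' := (D.leftExpect n).map_add
  map_smul' := (D.leftExpect n).map_smul

theorem aform_lmul (a : A) (x y : FormSpace hfin hφ) :
    aform (lmul a x) y = aform x (lmul (star a) y) := hfin.form_leftMul a x y

theorem aform_lexp (n : ℕ) (x y : FormSpace hfin hφ) :
    aform (lexp n x) y = aform x (lexp n y) := hfin.form_leftExpect n x y

/-- The value of a vector at an element of `A`. -/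
noncomputable def eval (b : A) : FormSpace hfin hφ →ₗ[ℂ] A :=
  (LinearMap.applyₗ b).comp D.eventuallyLinear.subtype

theorem ext_apply {x y : FormSpace hfin hφ} (h : ∀ b : A, eval b x = eval b y) : x = y :=
  Subtype.ext (LinearMap.ext h)

theorem lmul_mul (a b : A) (x : FormSpace hfin hφ) : lmul (a * b) x = lmul a (lmul b x) :=
  ext_apply fun _ => mul_assoc _ _ _

theorem lmul_one (x : FormSpace hfin hφ) : lmul 1 x = x := ext_apply fun _ => one_mul _

theorem lmul_zero (x : FormSpace hfin hφ) : lmul 0 x = 0 := ext_apply fun _ => zero_mul _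

theorem lmul_add (a b : A) (x : FormSpace hfin hφ) : lmul (a + b) x = lmul a x + lmul b x :=
  ext_apply fun _ => add_mul _ _ _

theorem lmul_algebraMap (c : ℂ) (x : FormSpace hfin hφ) : lmul (algebraMap ℂ A c) x = c • x :=
  ext_apply fun _ => (Algebra.smul_def _ _).symm

theorem lexp_lmul_lexp (n : ℕ) (a : A) (x : FormSpace hfin hφ) :
    lexp n (lmul a (lexp n x)) = lmul (D.E n a : A) (lexp n x) :=
  ext_apply fun _ => expect_mul_right (D.expect_mem n _) a

theorem lexp_lexp {m n : ℕ} (h : m ≤ n) (x : FormSpace hfin hφ) : lexp n (lexp m x) = lexp n x :=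
  ext_apply fun _ => expect_expect h _

theorem lexp_zero (x : FormSpace hfin hφ) : lexp 0 x = x := ext_apply fun _ => expect_zero _

theorem sum_lmul_lexp_lmul {n k : ℕ} {u v : Fin k → A} (h : D.IsBasis n u v)
    (x : FormSpace hfin hφ) : ∑ i, lmul (u i) (lexp n (lmul (v i) x)) = x := by
  refine ext_apply fun b => ?_
  rw [map_sum]
  exact h.left _

/-- Writing ‖a‖² − a*a = b*b gives ‖bx‖² + ‖ax‖² = ‖a‖²‖x‖². -/
theorem norm_lmul_le (a : A) (x : FormSpace hfin hφ) : ‖lmul a x‖ ≤ ‖a‖ * ‖x‖ := by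
  obtain ⟨b, hb⟩ : ∃ b : A, algebraMap ℂ A (‖a‖ ^ 2 : ℝ) - star a * a = star b * b := by
    let _ : PartialOrder A := CStarAlgebra.spectralOrder A
    let _ : StarOrderedRing A := CStarAlgebra.spectralOrderedRing A
    refine CStarAlgebra.nonneg_iff_eq_star_mul_self.1 (sub_nonneg.2 ?_)
    have h := IsSelfAdjoint.le_algebraMap_norm_self (IsSelfAdjoint.star_mul_self a)
    rwa [CStarRing.norm_star_mul_self, ← sq, IsScalarTower.algebraMap_apply ℝ ℂ A] at h
  have h1 : aform (lmul b x) (lmul b x) + aform (lmul a x) (lmul a x) =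
      ((‖a‖ ^ 2 : ℝ) : ℂ) • aform x x := by
    rw [aform_lmul, aform_lmul, ← aform_add_right, ← lmul_mul, ← lmul_mul, ← lmul_add, ← hb,
      sub_add_cancel, lmul_algebraMap, aform_smul_right]
  have h2 := congrArg (fun y => (φ y).re) h1
  simp only [map_add, map_smul, Complex.add_re, smul_eq_mul, Complex.re_ofReal_mul,
    ← norm_sq_eq] at h2
  refine (sq_le_sq₀ (norm_nonneg _) (by positivity)).1 ?_
  rw [mul_pow, ← h2]
  exact le_add_of_nonneg_left (sq_nonneg _)

theorem norm_lexp_le (n : ℕ) (x : FormSpace hfin hφ) : ‖lexp n x‖ ≤ 1 * ‖x‖ := by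
  have h1 : ‖lexp n x‖ * ‖lexp n x‖ ≤ ‖x‖ * ‖lexp n x‖ := by
    rw [← sq, norm_sq_eq, aform_lexp, lexp_lexp le_rfl, ← inner_def]
    exact re_inner_le_norm (𝕜 := ℂ) x (lexp n x)
  rw [one_mul]
  rcases (norm_nonneg (lexp n x)).eq_or_lt with h | h
  · rw [← h]; exact norm_nonneg x
  · exact le_of_mul_le_mul_right h1 h

variable (hfin hφ)

/-- The Hilbert space completion. -/
abbrev Hilbert : Type u := Completion (FormSpace hfin hφ)

/-- Left multiplication on the Hilbert space. -/
noncomputable def mulOp (a : A) : Hilbert hfin hφ →L[ℂ] Hilbert hfin hφ :=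
  ((lmul a).mkContinuous ‖a‖ (norm_lmul_le a)).completion

/-- The operator induced by `E n` on the Hilbert space. -/
noncomputable def expOp (n : ℕ) : Hilbert hfin hφ →L[ℂ] Hilbert hfin hφ :=
  ((lexp n).mkContinuous 1 (norm_lexp_le n)).completion

variable {hfin hφ}

@[simp]
theorem mulOp_coe (a : A) (x : FormSpace hfin hφ) : mulOp hfin hφ a x = lmul a x :=
  ContinuousLinearMap.completion_apply_coe _ _

@[simp]
theorem expOp_coe (n : ℕ) (x : FormSpace hfin hφ) : expOp hfin hφ n x = lexp n x :=
  ContinuousLinearMap.completion_apply_coe _ _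

theorem op_ext {S T : Hilbert hfin hφ →L[ℂ] Hilbert hfin hφ}
    (h : ∀ x : FormSpace hfin hφ, S x = T x) : S = T := by
  ext x
  induction x using induction_on with
  | hp => exact isClosed_eq S.continuous T.continuous
  | ih x => exact h x

theorem op_star_eq {S T : Hilbert hfin hφ →L[ℂ] Hilbert hfin hφ}
    (h : ∀ x y : FormSpace hfin hφ, inner ℂ (S x) (y : Hilbert hfin hφ) =
      inner ℂ (x : Hilbert hfin hφ) (T y)) : star T = S := by
  refine ((ContinuousLinearMap.eq_adjoint_iff S T).2 fun x y => ?_).symm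
  induction x, y using induction_on₂ with
  | hp => apply isClosed_eq <;> fun_prop
  | ih x y => exact h x y

variable (hfin hφ)

/-- The representation of the Toeplitz relations on the Hilbert space. -/
noncomputable def rep : ToeplitzRep D (Hilbert hfin hφ →L[ℂ] Hilbert hfin hφ) where
  φ :=
    { toFun := mulOp hfin hφ
      map_one' := op_ext fun x => by rw [mulOp_coe, lmul_one]; rfl
      map_mul' := fun a b => op_ext fun x => by
        rw [mul_apply_eq_comp, mulOp_coe, mulOp_coe, mulOp_coe, lmul_mul]
      map_zero' := op_ext fun x => by rw [mulOp_coe, lmul_zero]; rfl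
      map_add' := fun a b => op_ext fun x => by
        rw [_root_.add_apply, mulOp_coe, mulOp_coe, mulOp_coe, lmul_add, coe_add]
      commutes' := fun c => op_ext fun x => by
        rw [mulOp_coe, lmul_algebraMap, coe_smul, Algebra.algebraMap_eq_smul_one]; rfl
      map_star' := fun a => by
        refine (op_star_eq fun x y => ?_).symm
        rw [mulOp_coe, mulOp_coe, inner_coe, inner_coe, inner_def, inner_def, aform_lmul,
          star_star] }
  e := expOp hfin hφ
  isStarProjection n := by
    refine ⟨op_ext fun x => ?_, op_star_eq fun x y => ?_⟩
    · rw [mul_apply_eq_comp, expOp_coe, expOp_coe, lexp_lexp le_rfl]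
    · rw [expOp_coe, expOp_coe, inner_coe, inner_coe, inner_def, inner_def, aform_lexp]
  e_zero := op_ext fun x => by rw [expOp_coe, lexp_zero]; rfl
  e_succ_mul n := op_ext fun x => by
    rw [mul_apply_eq_comp, expOp_coe, expOp_coe, expOp_coe, lexp_lexp n.le_succ]
  e_mul_mul n a := op_ext fun x => by
    change expOp hfin hφ n (mulOp hfin hφ a (expOp hfin hφ n x)) =
      mulOp hfin hφ (D.E n a) (expOp hfin hφ n x)
    rw [expOp_coe, mulOp_coe, expOp_coe, mulOp_coe, lexp_lmul_lexp]

/-- The cyclic vector. -/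
noncomputable def vac : FormSpace hfin hφ := D.idVec

theorem inner_vac (n : ℕ) (a b : A) :
    inner ℂ (vac hfin hφ : Hilbert hfin hφ)
      (((rep hfin hφ).φ a * (rep hfin hφ).e n * (rep hfin hφ).φ b) (vac hfin hφ)) =
      φ (a * D.lamInvProd n * b) := by
  change inner ℂ (vac hfin hφ : Hilbert hfin hφ) (mulOp hfin hφ a (expOp hfin hφ n
    (mulOp hfin hφ b (vac hfin hφ)))) = _
  rw [mulOp_coe, expOp_coe, mulOp_coe, inner_coe, inner_def]
  exact congrArg φ (hfin.form_idVec n a b)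

theorem norm_vac : ‖(vac hfin hφ : Hilbert hfin hφ)‖ = 1 := by
  have h := inner_vac hfin hφ 0 1 1
  rw [map_one, (rep hfin hφ).e_zero, lamInvProd_zero] at h
  simp only [mul_one, one_apply_eq_self, hφ.map_one] at h
  have h' : ‖(vac hfin hφ : Hilbert hfin hφ)‖ ^ 2 = 1 := by
    rw [← inner_self_eq_norm_sq (𝕜 := ℂ), h]
    simp
  exact (pow_eq_one_iff_of_nonneg (norm_nonneg _) two_ne_zero).1 h'

/-- The product defining the Toeplitz algebra runs over nonzero algebras only; the unit vector `vac`
makes this one eligible. -/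
instance : Nontrivial (Hilbert hfin hφ →L[ℂ] Hilbert hfin hφ) := by
  have : Nontrivial (Hilbert hfin hφ) := by
    refine ⟨vac hfin hφ, 0, fun h => ?_⟩
    have := norm_vac hfin hφ
    rw [h, norm_zero] at this
    exact zero_ne_one this
  infer_instance

/-- The identity is a finite sum of operators `a e n b`. -/
theorem sum_rep {n k : ℕ} {u v : Fin k → A} (h : D.IsBasis n u v) :
    ∑ i, (rep hfin hφ).φ (u i) * (rep hfin hφ).e n * (rep hfin hφ).φ (v i) = 1 := by
  refine op_ext fun x => ?_
  rw [_root_.sum_apply]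
  conv_rhs => rw [one_apply_eq_self, ← sum_lmul_lexp_lmul h x]
  have hc : ∀ (s : Finset (Fin k)) (f : Fin k → FormSpace hfin hφ),
      ((∑ i ∈ s, f i : FormSpace hfin hφ) : Hilbert hfin hφ) = ∑ i ∈ s, (f i : Hilbert hfin hφ) :=
    fun s f => map_sum (toCompl (α := FormSpace hfin hφ)) f s
  rw [hc]
  refine Finset.sum_congr rfl fun i _ => ?_
  change mulOp hfin hφ (u i) (expOp hfin hφ n (mulOp hfin hφ (v i) x)) = _
  rw [mulOp_coe, expOp_coe, mulOp_coe]

end FormSpace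

end System

/-! ### Monomials in the Toeplitz algebra, and representations of its quotient. -/

namespace System

variable {A : Type u} [CStarAlgebra A] {D : System A}

/-- The representation of the Toeplitz algebra given by a representation of the relations. -/
noncomputable def coordHom (ρ : SomeToeplitzRep D) : D.Toeplitz →⋆ₐ[ℂ] ρ.B where
  toFun x := (x : D.RepProd) ρ
  map_one' := rfl
  map_mul' _ _ := rfl
  map_zero' := rfl
  map_add' _ _ := rfl
  commutes' _ := rfl
  map_star' _ := rfl

theorem toeplitz_ext {x y : D.Toeplitz} (h : ∀ ρ : SomeToeplitzRep D, coordHom ρ x = coordHom ρ y) :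
    x = y := Subtype.ext (lp.ext (funext h))

@[simp]
theorem coordHom_inclT (ρ : SomeToeplitzRep D) (a : A) : coordHom ρ (D.inclT a) = ρ.rep.φ a := rfl

@[simp]
theorem coordHom_eT (ρ : SomeToeplitzRep D) (n : ℕ) : coordHom ρ (D.eT n) = ρ.rep.e n := rfl

theorem eT_mul_inclT_mul_eT (n : ℕ) (a : A) :
    D.eT n * D.inclT a * D.eT n = D.inclT (D.expect n a) * D.eT n :=
  toeplitz_ext fun ρ => by
    simp only [map_mul, coordHom_inclT, coordHom_eT, ρ.rep.e_mul_mul]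
    rfl

theorem eT_zero : D.eT 0 = 1 := toeplitz_ext fun ρ => ρ.rep.e_zero

theorem star_eT (n : ℕ) : star (D.eT n) = D.eT n :=
  toeplitz_ext fun ρ => (map_star (coordHom ρ) _).trans (ρ.rep.isStarProjection n).isSelfAdjoint

theorem eT_mul_eT {m n : ℕ} (h : m ≤ n) : D.eT n * D.eT m = D.eT n := by
  refine toeplitz_ext fun ρ => ?_
  rw [map_mul, coordHom_eT, coordHom_eT]
  induction n, h using Nat.le_induction with
  | base => exact (ρ.rep.isStarProjection m).isIdempotentElem
  | succ n h ih => rw [← ρ.rep.e_succ_mul, mul_assoc, ih]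

/-- Compare ê r ê = r ê with the adjoint of the same relation for r*. -/
theorem commute_eT {n : ℕ} {r : A} (hr : r ∈ D.R n) : D.inclT r * D.eT n = D.eT n * D.inclT r := by
  have h1 : ∀ r ∈ D.R n, D.eT n * D.inclT r * D.eT n = D.inclT r * D.eT n := fun r hr => by
    rw [eT_mul_inclT_mul_eT, expect_of_mem hr]
  have h2 := congrArg star (h1 (star r) (star_mem hr))
  rw [star_mul, star_mul, star_mul, star_eT, map_star, star_star, ← mul_assoc, h1 r hr] at h2
  exact h2

theorem eT_mul_inclT_mul_eT_of_le {m n : ℕ} (h : m ≤ n) (a : A) :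
    D.eT n * D.inclT a * D.eT m = D.eT n * D.inclT (D.expect m a) := by
  rw [← eT_mul_eT h, mul_assoc, mul_assoc, ← mul_assoc (D.eT m), eT_mul_inclT_mul_eT,
    commute_eT (D.expect_mem m a), mul_assoc]

theorem eT_mul_inclT_mul_eT_of_ge {m n : ℕ} (h : n ≤ m) (a : A) :
    D.eT n * D.inclT a * D.eT m = D.inclT (D.expect n a) * D.eT m := by
  have := congrArg star (eT_mul_inclT_mul_eT_of_le (D := D) h (star a))
  rwa [star_mul, star_mul, star_mul, star_eT, star_eT, ← map_star, ← map_star, star_star, ← mul_assoc,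
    ← expect_star, star_star] at this

/-- The linear span of the elements `a ê n b`. -/
noncomputable def monomialSpan (D : System A) : Submodule ℂ D.Toeplitz :=
  Submodule.span ℂ {x | ∃ (n : ℕ) (a b : A), x = D.inclT a * D.eT n * D.inclT b}

theorem monomial_mem (n : ℕ) (a b : A) : D.inclT a * D.eT n * D.inclT b ∈ D.monomialSpan :=
  Submodule.subset_span ⟨n, a, b, rfl⟩

/-- In a product of two monomials, the projection of larger index absorbs the other, at the cost of
an expectation of the middle factor. -/
theorem mul_mem_monomialSpan {x y : D.Toeplitz} (hx : x ∈ D.monomialSpan)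
    (hy : y ∈ D.monomialSpan) : x * y ∈ D.monomialSpan := by
  rw [monomialSpan] at hx hy
  induction hx, hy using Submodule.span_induction₂ with
  | mem_mem x y hx hy =>
    obtain ⟨n, a, b, rfl⟩ := hx
    obtain ⟨m, c, d, rfl⟩ := hy
    have : D.inclT a * D.eT n * D.inclT b * (D.inclT c * D.eT m * D.inclT d) =
        D.inclT a * (D.eT n * D.inclT (b * c) * D.eT m) * D.inclT d := by
      simp only [map_mul, mul_assoc]
    rw [this]
    rcases le_total m n with h | h
    · rw [eT_mul_inclT_mul_eT_of_le h, ← mul_assoc, mul_assoc _ (D.inclT _) (D.inclT d), ← map_mul]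
      exact monomial_mem _ _ _
    · rw [eT_mul_inclT_mul_eT_of_ge h, ← mul_assoc, ← map_mul]
      exact monomial_mem _ _ _
  | zero_left y hy => rw [zero_mul]; exact zero_mem _
  | zero_right x hx => rw [mul_zero]; exact zero_mem _
  | add_left x y z _ _ _ h1 h2 => rw [add_mul]; exact add_mem h1 h2
  | add_right x y z _ _ _ h1 h2 => rw [mul_add]; exact add_mem h1 h2
  | smul_left c x y _ _ h => rw [smul_mul_assoc]; exact Submodule.smul_mem _ c h
  | smul_right c x y _ _ h => rw [mul_smul_comm]; exact Submodule.smul_mem _ c h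

theorem star_mem_monomialSpan {x : D.Toeplitz} (hx : x ∈ D.monomialSpan) :
    star x ∈ D.monomialSpan := by
  rw [monomialSpan] at hx
  induction hx using Submodule.span_induction with
  | mem x hx =>
    obtain ⟨n, a, b, rfl⟩ := hx
    rw [star_mul, star_mul, star_eT, ← map_star, ← map_star, ← mul_assoc]
    exact monomial_mem _ _ _
  | zero => rw [star_zero]; exact zero_mem _
  | add x y _ _ h1 h2 => rw [star_add]; exact add_mem h1 h2
  | smul c x _ h => rw [star_smul]; exact Submodule.smul_mem _ _ h

theorem inclT_mem_monomialSpan (a : A) : D.inclT a ∈ D.monomialSpan := by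
  simpa [eT_zero] using monomial_mem (D := D) 0 a 1

theorem eT_mem_monomialSpan (n : ℕ) : D.eT n ∈ D.monomialSpan := by
  simpa using monomial_mem (D := D) n 1 1

theorem dense_monomialSpan : Dense (D.monomialSpan : Set D.Toeplitz) := by
  have h1 : ∀ y ∈ StarAlgebra.adjoin ℂ (Set.range D.prodA ∪ Set.range D.prodE),
      ∃ x ∈ D.monomialSpan, (x : D.RepProd) = y := by
    intro y hy
    induction hy using StarAlgebra.adjoin_induction with
    | mem y hy =>
      rcases hy with ⟨a, rfl⟩ | ⟨n, rfl⟩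
      · exact ⟨_, inclT_mem_monomialSpan a, rfl⟩
      · exact ⟨_, eT_mem_monomialSpan n, rfl⟩
    | algebraMap c =>
      exact ⟨_, inclT_mem_monomialSpan (algebraMap ℂ A c), D.prodA.toAlgHom.commutes c⟩
    | add y z _ _ h1 h2 =>
      obtain ⟨x, hx, rfl⟩ := h1
      obtain ⟨w, hw, rfl⟩ := h2
      exact ⟨_, add_mem hx hw, rfl⟩
    | mul y z _ _ h1 h2 =>
      obtain ⟨x, hx, rfl⟩ := h1
      obtain ⟨w, hw, rfl⟩ := h2
      exact ⟨_, mul_mem_monomialSpan hx hw, rfl⟩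
    | star y _ h1 =>
      obtain ⟨x, hx, rfl⟩ := h1
      exact ⟨_, star_mem_monomialSpan hx, rfl⟩
  intro x
  rw [Metric.mem_closure_iff]
  intro ε hε
  obtain ⟨y, hy, hxy⟩ := Metric.mem_closure_iff.1 (show (x : D.RepProd) ∈ closure
    (StarAlgebra.adjoin ℂ (Set.range D.prodA ∪ Set.range D.prodE) : Set D.RepProd) from x.2) ε hε
  obtain ⟨z, hz, rfl⟩ := h1 y hy
  exact ⟨z, hz, hxy⟩

/-! ### The redundancy ideal -/

theorem mem_kT (n : ℕ) (a b : A) : D.inclT a * D.eT n * D.inclT b ∈ D.kT n :=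
  Submodule.le_topologicalClosure _ (Submodule.subset_span ⟨a, b, rfl⟩)

/-- The unit `∑ u i ê n v i` of `𝒦̂ n` given by a quasi-basis. -/
noncomputable def unitT (D : System A) (n : ℕ) {k : ℕ} (u v : Fin k → A) : D.Toeplitz :=
  ∑ i, D.inclT (u i) * D.eT n * D.inclT (v i)

theorem unitT_mem {n k : ℕ} (u v : Fin k → A) : D.unitT n u v ∈ D.kT n :=
  Submodule.sum_mem _ fun _ _ => mem_kT _ _ _

theorem unitT_mul {n k : ℕ} {u v : Fin k → A} (h : D.IsBasis n u v) {x : D.Toeplitz}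
    (hx : x ∈ D.kT n) : D.unitT n u v * x = x := by
  have hcl : IsClosed {x : D.Toeplitz | D.unitT n u v * x = x} :=
    isClosed_eq (continuous_const.mul continuous_id) continuous_id
  refine closure_minimal (fun y hy => ?_) hcl hx
  induction hy using Submodule.span_induction with
  | mem y hy =>
    obtain ⟨a, b, rfl⟩ := hy
    have : ∀ i, D.inclT (u i) * D.eT n * D.inclT (v i) * (D.inclT a * D.eT n * D.inclT b) =
        D.inclT (u i * D.expect n (v i * a)) * (D.eT n * D.inclT b) := fun i => by
      rw [map_mul, mul_assoc (D.inclT (u i)) (D.inclT _), ← mul_assoc (D.inclT (D.expect n _)),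
        ← eT_mul_inclT_mul_eT]
      simp only [map_mul, mul_assoc]
    rw [Set.mem_ofPred_eq, unitT, Finset.sum_mul]
    simp_rw [this]
    rw [← Finset.sum_mul, ← map_sum, h.left, mul_assoc]
  | zero => exact mul_zero _
  | add y z _ _ h1 h2 => exact (mul_add _ _ _).trans (congrArg₂ _ h1 h2)
  | smul c y _ h => exact (mul_smul_comm _ _ _).trans (congrArg _ h)

theorem one_sub_unitT_mem {n k : ℕ} {u v : Fin k → A} (h : D.IsBasis n u v) :
    1 - D.unitT n u v ∈ D.redundancyIdeal := by
  rw [redundancyIdeal, Submodule.mem_sInf]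
  rintro J ⟨-, -, hJ⟩
  -- The redundancy has 1 = ê_0 in position 0 and minus the unit of 𝒦̂_n in position n. A difference
  -- of `Pi.single`s also covers n = 0, where the two positions coincide.
  have hs : ∑ i, (Pi.single 0 1 - Pi.single (Fin.last n) (D.unitT n u v) :
      Fin (n + 1) → D.Toeplitz) i = 1 - D.unitT n u v := by
    simp only [Pi.sub_apply, Finset.sum_sub_distrib, Finset.sum_pi_single',
      Finset.mem_univ, if_true]
  rw [← hs]
  refine hJ n _ ⟨fun i => ?_, fun x hx => ?_⟩
  · refine sub_mem ?_ ?_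
    · rcases eq_or_ne i 0 with rfl | hi
      · rw [Pi.single_eq_same]
        simpa [eT_zero] using mem_kT (D := D) 0 1 1
      · rw [Pi.single_eq_of_ne hi]
        exact zero_mem _
    · rcases eq_or_ne i (Fin.last n) with rfl | hi
      · rw [Pi.single_eq_same]
        exact unitT_mem u v
      · rw [Pi.single_eq_of_ne hi]
        exact zero_mem _
  · rw [← Finset.sum_mul, hs, sub_mul, one_mul, unitT_mul h hx, sub_self]

theorem q_surjective : Function.Surjective D.q := Ideal.Quotient.mk_surjective

theorem q_eq_zero {x : D.Toeplitz} (hx : x ∈ D.redundancyIdeal) : D.q x = 0 :=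
  Ideal.Quotient.eq_zero_iff_mem.2 hx

theorem sum_incl_mul_e {n k : ℕ} {u v : Fin k → A} (h : D.IsBasis n u v) :
    ∑ i, D.incl (u i) * D.e n * D.incl (v i) = 1 := by
  have h1 := q_eq_zero (one_sub_unitT_mem h)
  rw [map_sub, map_one, sub_eq_zero, unitT, map_sum] at h1
  rw [h1]
  simp only [map_mul]
  rfl

/-- A representation in which the units of all `𝒦̂ n` act as the identity kills all redundancies. -/
theorem redundancyIdeal_le_ker (ρ : SomeToeplitzRep D)
    (h : ∀ n, ∃ (k : ℕ) (u v : Fin k → A), coordHom ρ (D.unitT n u v) = 1) :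
    D.redundancyIdeal ≤ RingHom.ker (coordHom ρ) := by
  refine sInf_le ⟨inferInstance, ?_, fun n k hk => ?_⟩
  · have hc : Continuous (coordHom ρ) :=
      AddMonoidHomClass.continuous_of_bound (coordHom ρ) 1 fun x => by
        rw [one_mul]; exact NonUnitalStarAlgHom.norm_apply_le (coordHom ρ) x
    exact isClosed_singleton.preimage hc
  · obtain ⟨l, u, v, hu⟩ := h n
    -- The unit lies in 𝒦̂_n, so a redundancy annihilates it, while its image is 1.
    rw [RingHom.mem_ker, ← mul_one (coordHom ρ _), ← hu, ← map_mul, Finset.sum_mul,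
      hk.sum_mul _ (unitT_mem u v), map_zero]

/-- The representation of the quotient algebra given by a representation of the Toeplitz algebra
killing the redundancy ideal. -/
noncomputable def quotHom (ρ : SomeToeplitzRep D)
    (h : D.redundancyIdeal ≤ RingHom.ker (coordHom ρ)) : D.CStar →⋆ₐ[ℂ] ρ.B :=
  let f : D.CStar →+* ρ.B :=
    Ideal.Quotient.lift D.redundancyIdeal (coordHom ρ : D.Toeplitz →+* ρ.B) fun _ ha => h ha
  { f with
    commutes' := fun c => (coordHom ρ).toAlgHom.commutes c
    map_star' := fun x => by
      obtain ⟨t, rfl⟩ := q_surjective x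
      exact map_star (coordHom ρ) t }

end System

/-! ### Gluing functionals into a conditional expectation, and uniqueness. -/

section Extension

variable {A : Type*} [CStarAlgebra A] {T : Type*} [CStarAlgebra T]
  {H : Type*} [NormedAddCommGroup H] [InnerProductSpace ℂ H] [CompleteSpace H]

/-- The vector functional of a representation on a Hilbert space at a unit vector. -/
noncomputable def vectorFunctional (π : T →⋆ₐ[ℂ] (H →L[ℂ] H)) {ξ : H} (hξ : ‖ξ‖ = 1) : T →L[ℂ] ℂ :=
  LinearMap.mkContinuous
    { toFun := fun x => inner ℂ ξ (π x ξ)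
      map_add' := fun x y => by rw [map_add, _root_.add_apply, inner_add_right]
      map_smul' := fun c x => by
        rw [map_smul, _root_.smul_apply, inner_smul_right]; rfl } 1
    fun x => by
      refine (norm_inner_le_norm (𝕜 := ℂ) _ _).trans ?_
      rw [hξ, one_mul, one_mul]
      refine (ContinuousLinearMap.le_opNorm _ _).trans ?_
      rw [hξ, mul_one]
      exact NonUnitalStarAlgHom.norm_apply_le π x

theorem vectorFunctional_apply (π : T →⋆ₐ[ℂ] (H →L[ℂ] H)) {ξ : H} (hξ : ‖ξ‖ = 1) (x : T) :
    vectorFunctional π hξ x = inner ℂ ξ (π x ξ) := rfl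

theorem norm_vectorFunctional_le (π : T →⋆ₐ[ℂ] (H →L[ℂ] H)) {ξ : H} (hξ : ‖ξ‖ = 1) (x : T) :
    ‖vectorFunctional π hξ x‖ ≤ ‖x‖ :=
  (ContinuousLinearMap.le_of_opNorm_le _ (LinearMap.mkContinuous_norm_le _ zero_le_one _) x).trans_eq
    (one_mul _)

theorem vectorFunctional_star_mul_self (π : T →⋆ₐ[ℂ] (H →L[ℂ] H)) {ξ : H} (hξ : ‖ξ‖ = 1) (x : T) :
    ∃ r : ℝ, 0 ≤ r ∧ vectorFunctional π hξ (star x * x) = r := by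
  refine ⟨‖π x ξ‖ ^ 2, by positivity, ?_⟩
  rw [vectorFunctional_apply, map_mul, map_star, mul_apply_eq_comp,
    ContinuousLinearMap.star_eq_adjoint, ContinuousLinearMap.adjoint_inner_right,
    inner_self_eq_norm_sq_to_K]
  norm_cast

variable {j : A →⋆ₐ[ℂ] T} {e : ℕ → T} {c : ℕ → A}

/-- Continuous linear maps are determined by their values at the monomials `a e n b`, if these span
a dense subspace. -/
theorem ext_of_dense_span {F : Type*} [NormedAddCommGroup F] [NormedSpace ℂ F] {S S' : T →L[ℂ] F}
    (hd : Dense (Submodule.span ℂ {x | ∃ (n : ℕ) (a b : A), x = j a * e n * j b} : Set T))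
    (h : ∀ n a b, S (j a * e n * j b) = S' (j a * e n * j b)) : S = S' := by
  refine ContinuousLinearMap.ext fun x => ?_
  refine congrFun (Continuous.ext_on hd S.continuous S'.continuous fun y hy => ?_) x
  refine LinearMap.eqOn_span (f := S.toLinearMap) (g := S'.toLinearMap) ?_ hy
  rintro _ ⟨n, a, b, rfl⟩
  exact h n a b

/-- If every state `φ` of `A` extends to a positive contractive functional on `T` with values
`φ (a c n b)` at the monomials `a e n b`, then there is a conditional expectation onto `A` with
values `a c n b` at these monomials. -/
theorem exists_conditionalExpectation
    (hd : Dense (Submodule.span ℂ {x | ∃ (n : ℕ) (a b : A), x = j a * e n * j b} : Set T))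
    (he : e 0 = 1) (hc : c 0 = 1)
    (hψ : ∀ φ : A →ₗ[ℂ] ℂ, IsState φ → ∃ ψ : T →L[ℂ] ℂ, (∀ x, ‖ψ x‖ ≤ ‖x‖) ∧
      (∀ x, ∃ r : ℝ, 0 ≤ r ∧ ψ (star x * x) = r) ∧
      ∀ n a b, ψ (j a * e n * j b) = φ (a * c n * b)) :
    ∃ G : T →ₗ[ℂ] A, IsConditionalExpectation j G ∧
      ∀ n a b, G (j a * e n * j b) = a * c n * b := by
  let p : (ℕ × A × A →₀ ℂ) →ₗ[ℂ] T :=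
    Finsupp.linearCombination ℂ fun s => j s.2.1 * e s.1 * j s.2.2
  let g : (ℕ × A × A →₀ ℂ) →ₗ[ℂ] A := Finsupp.linearCombination ℂ fun s => s.2.1 * c s.1 * s.2.2
  have hp : DenseRange p := by
    refine Dense.mono (Submodule.span_le.2 ?_ : _ ≤ LinearMap.range p) hd
    rintro _ ⟨n, a, b, rfl⟩
    exact ⟨Finsupp.single (n, a, b) 1, by
      rw [Finsupp.linearCombination_single, one_smul]⟩
  -- This bound gives both well-definedness (relations among monomials are respected) and the
  -- continuous extension from their span.
  have hb : ∀ f, ‖g f‖ ≤ 2 * ‖p f‖ := fun f => by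
    refine norm_le_of_forall_isState (fun φ hφ => ?_) (norm_nonneg _)
    obtain ⟨ψ, hn, -, hm⟩ := hψ φ hφ
    have h1 : φ ∘ₗ g = ψ.toLinearMap ∘ₗ p := by
      refine Finsupp.lhom_ext' fun s => LinearMap.ext_ring ?_
      change φ (g (Finsupp.single s 1)) = ψ (p (Finsupp.single s 1))
      rw [Finsupp.linearCombination_single, Finsupp.linearCombination_single, one_smul, one_smul, hm]
    exact (congrArg norm (LinearMap.congr_fun h1 f)).trans_le (hn _)
  let G : T →L[ℂ] A := g.extendOfNorm p
  have hG : ∀ n a b, G (j a * e n * j b) = a * c n * b := fun n a b => by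
    have h1 := LinearMap.extendOfNorm_eq hp ⟨2, hb⟩ (Finsupp.single (n, a, b) 1)
    rwa [Finsupp.linearCombination_single, Finsupp.linearCombination_single, one_smul,
      one_smul] at h1
  refine ⟨G.toLinearMap, ⟨fun a => ?_, fun a x => ?_, fun x a => ?_, fun x => ?_⟩, hG⟩
  · simpa [he, hc] using hG 0 a 1
  · have : G.comp (ContinuousLinearMap.mul ℂ T (j a)) =
        (ContinuousLinearMap.mul ℂ A a).comp G := ext_of_dense_span hd fun n b d => by
      simp only [ContinuousLinearMap.comp_apply, ContinuousLinearMap.mul_apply', hG]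
      rw [← mul_assoc, ← mul_assoc, ← map_mul, hG]
      simp only [mul_assoc]
    exact DFunLike.congr_fun this x
  · have : G.comp ((ContinuousLinearMap.mul ℂ T).flip (j a)) =
        ((ContinuousLinearMap.mul ℂ A).flip a).comp G := ext_of_dense_span hd fun n b d => by
      simp only [ContinuousLinearMap.comp_apply, ContinuousLinearMap.mul_apply',
        ContinuousLinearMap.flip_apply, hG]
      rw [mul_assoc, ← map_mul, hG]
      simp only [mul_assoc]
    exact DFunLike.congr_fun this x
  -- Positivity is tested on states: φ ∘ G and ψ agree on monomials, hence everywhere, and ψ is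
  -- positive. Continuity of φ comes from φ = ψ ∘ j, the case n = 0.
  · refine exists_eq_star_mul_self_of_forall_isState fun φ hφ => ?_
    obtain ⟨ψ, hn, hpos, hm⟩ := hψ φ hφ
    have hφn : ∀ a, ‖φ a‖ ≤ ‖a‖ := fun a => by
      have h1 := hm 0 a 1
      rw [he, hc, map_one, mul_one, mul_one, mul_one, mul_one] at h1
      rw [← h1]
      exact (hn _).trans (NonUnitalStarAlgHom.norm_apply_le j a)
    have : (φ.mkContinuous 1 fun a => (hφn a).trans_eq (one_mul _).symm).comp G = ψ :=
      ext_of_dense_span hd fun n a b => by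
        rw [ContinuousLinearMap.comp_apply, hG, LinearMap.mkContinuous_apply, hm]
    obtain ⟨r, hr, hrx⟩ := hpos x
    exact ⟨r, hr, (DFunLike.congr_fun this (star x * x)).trans hrx⟩

theorem IsConditionalExpectation.continuous {G : T →ₗ[ℂ] A} (hG : IsConditionalExpectation j G) :
    Continuous G := by
  let _ : PartialOrder A := CStarAlgebra.spectralOrder A
  let _ : StarOrderedRing A := CStarAlgebra.spectralOrderedRing A
  let _ : PartialOrder T := CStarAlgebra.spectralOrder T
  let _ : StarOrderedRing T := CStarAlgebra.spectralOrderedRing T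
  let P : T →ₚ[ℂ] A := PositiveLinearMap.mk₀ G fun x hx => by
    obtain ⟨y, rfl⟩ := CStarAlgebra.nonneg_iff_eq_star_mul_self.1 hx
    exact CStarAlgebra.nonneg_iff_eq_star_mul_self.2 (hG.positive y)
  obtain ⟨C, hC⟩ := PositiveLinearMap.exists_norm_apply_le P
  exact AddMonoidHomClass.continuous_of_bound G C hC

/-- If `A` is commutative and `1` is, for each `n`, a finite sum of monomials `a e n b`, then there
is at most one conditional expectation onto `A`. -/
theorem IsConditionalExpectation.eq_of_comm
    (hd : Dense (Submodule.span ℂ {x | ∃ (n : ℕ) (a b : A), x = j a * e n * j b} : Set T))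
    (hone : ∀ n, ∃ (k : ℕ) (u v : Fin k → A), ∑ i, j (u i) * e n * j (v i) = 1)
    (hcomm : ∀ a b : A, a * b = b * a) {G G' : T →ₗ[ℂ] A} (hG : IsConditionalExpectation j G)
    (hG' : IsConditionalExpectation j G') : G = G' := by
  -- Apply G to the decomposition of 1 and use commutativity to pull out G(e_n).
  have key : ∀ {G : T →ₗ[ℂ] A}, IsConditionalExpectation j G → ∀ n (k : ℕ) (u v : Fin k → A),
      ∑ i, j (u i) * e n * j (v i) = 1 → G (e n) * ∑ i, u i * v i = 1 := by
    intro G hG n k u v h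
    have h1 := hG.map_one
    rw [← h, map_sum] at h1
    rw [← h1, Finset.mul_sum]
    refine Finset.sum_congr rfl fun i _ => ?_
    rw [hG.map_mul_incl, hG.map_incl_mul, ← mul_assoc, hcomm (u i)]
  have he : ∀ n, G (e n) = G' (e n) := fun n => by
    obtain ⟨k, u, v, h⟩ := hone n
    refine left_inv_eq_right_inv (key hG n k u v h) ?_
    rw [hcomm]
    exact key hG' n k u v h
  let S : T →L[ℂ] A := ⟨G, hG.continuous⟩
  let S' : T →L[ℂ] A := ⟨G', hG'.continuous⟩
  have : S = S' := ext_of_dense_span hd fun n a b => by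
    change G _ = G' _
    rw [hG.map_mul_incl, hG.map_incl_mul, hG'.map_mul_incl, hG'.map_incl_mul, he]
  exact congrArg ContinuousLinearMap.toLinearMap this

end Extension

/-! ### Assembling the state representations on C*(ℛ, ℰ). -/

namespace System

open UniformSpace FormSpace

variable {A : Type u} [CStarAlgebra A] {D : System A}

section StateRep

variable (hfin : D.FiniteIndex) {φ : A →ₗ[ℂ] ℂ} (hφ : IsState φ)

/-- The representation on the Hilbert space of a state. -/
noncomputable def stateRep : SomeToeplitzRep D where
  -- The Hilbert space lives in the universe of `A`, so this algebra is one of the factors of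
  -- `RepProd` and evaluation at it is the desired representation.
  B := Hilbert hfin hφ →L[ℂ] Hilbert hfin hφ
  rep := rep hfin hφ

theorem redundancyIdeal_le_ker_stateRep :
    D.redundancyIdeal ≤ RingHom.ker (coordHom (stateRep hfin hφ)) := by
  refine redundancyIdeal_le_ker _ fun n => ?_
  obtain ⟨k, u, v, hq⟩ := hfin n
  refine ⟨k, u, v, ?_⟩
  rw [unitT, map_sum]
  simp only [map_mul, coordHom_inclT, coordHom_eT]
  exact sum_rep hfin hφ (isBasis_of_isQuasiBasis hq)

/-- The representation of `C*(ℛ, ℰ)` on the Hilbert space of a state. -/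
noncomputable def stateHom : D.CStar →⋆ₐ[ℂ] (Hilbert hfin hφ →L[ℂ] Hilbert hfin hφ) :=
  quotHom (stateRep hfin hφ) (redundancyIdeal_le_ker_stateRep hfin hφ)

end StateRep

theorem continuous_q : Continuous D.q :=
  AddMonoidHomClass.continuous_of_bound D.q 1 fun x => by
    rw [one_mul]; exact NonUnitalStarAlgHom.norm_apply_le D.q x

theorem dense_span_monomials : Dense (Submodule.span ℂ
    {x | ∃ (n : ℕ) (a b : A), x = D.incl a * D.e n * D.incl b} : Set D.CStar) := by
  have h := q_surjective.denseRange.dense_image continuous_q (dense_monomialSpan (D := D))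
  refine h.mono ?_
  rintro _ ⟨x, hx, rfl⟩
  rw [SetLike.mem_coe, monomialSpan] at hx
  induction hx using Submodule.span_induction with
  | mem x hx =>
    obtain ⟨n, a, b, rfl⟩ := hx
    refine Submodule.subset_span ⟨n, a, b, ?_⟩
    rw [map_mul, map_mul]
    rfl
  | zero => rw [map_zero]; exact Submodule.zero_mem _
  | add x y _ _ h1 h2 => rw [map_add]; exact Submodule.add_mem _ h1 h2
  | smul c x _ h => rw [map_smul]; exact Submodule.smul_mem _ c h

theorem e_zero : D.e 0 = 1 := by rw [e, eT_zero, map_one]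

end System
end ApproxProper

theorem proposition6p5 {A : Type u} [CStarAlgebra A] (D : ApproxProper.System A)
    (hfin : ∀ n, ApproxProper.IsIndexFinite (D.R n).subtype (D.E n)) :
    (∀ n, ApproxProper.IsIndexFinite (D.inclR n) (D.restrE n) ∧ IsUnit (D.lam n)) ∧
    ∃ G : D.CStar →ₗ[ℂ] A,
      ApproxProper.IsConditionalExpectation D.incl G ∧
      (∀ n, G (D.e n) = D.lamInvProd n) ∧
      ((∀ a b : A, a * b = b * a) →
        ∀ G' : D.CStar →ₗ[ℂ] A, ApproxProper.IsConditionalExpectation D.incl G' → G' = G) := by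
  have hfin' : D.FiniteIndex := hfin
  obtain ⟨G, hG, hGm⟩ := ApproxProper.exists_conditionalExpectation (c := D.lamInvProd)
    (ApproxProper.System.dense_span_monomials (D := D)) ApproxProper.System.e_zero
    ApproxProper.System.lamInvProd_zero fun φ hφ =>
      ⟨ApproxProper.vectorFunctional (ApproxProper.System.stateHom hfin' hφ)
        (ApproxProper.System.FormSpace.norm_vac hfin' hφ),
        ApproxProper.norm_vectorFunctional_le _ _,
        ApproxProper.vectorFunctional_star_mul_self _ _,
        ApproxProper.System.FormSpace.inner_vac hfin' hφ⟩
  refine ⟨fun n => ⟨D.isIndexFinite_restrE n (hfin (n + 1)), hfin'.isUnit_lam n⟩, G, hG,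
    fun n => by simpa using hGm n 1 1, fun hcomm G' hG' => ?_⟩
  refine hG'.eq_of_comm ApproxProper.System.dense_span_monomials (fun n => ?_) hcomm hG
  obtain ⟨k, u, v, hq⟩ := hfin n
  exact ⟨k, u, v,
    ApproxProper.System.sum_incl_mul_e (ApproxProper.System.isBasis_of_isQuasiBasis hq)⟩
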